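/- Let $k$ be a field and let $B=k[x_1,\dots,x_n]$ be the polynomial ring with its standard grading ($\deg x_j=1$). Let $C\subseteq B$ be a graded $k$-subalgebra (it contains the homogeneous components of its elements) such that the inclusion $C\hookrightarrow B$ is split as a map of $C$-modules, and let $I=C_+B$ be the ideal of $B$ generated by the elements of $C$ of positive degree. For a graded module $M$, let $\operatorname{end}(M)\in\mathbb Z\cup\{\pm\infty\}$ be the largest degree in which $M$ is nonzero ($\infty$ if there is no bound on such degrees, $-\infty$ if $M=0$). For $A=B$ or $A=C$ and a graded $A$-module $M$, put $t^A_i(M)=\operatorname{end}(\operatorname{Tor}^A_i(M,k))$, where $k=A/A_+$ and $\operatorname{Tor}$ carries its internal grading. Then $$t^C_0(k)=0,\qquad t^C_1(k)\le \operatorname{end}(B/I)+1,\qquad t^C_i(k)\le(\operatorname{end}(B/I)+2)\,i-2\quad\text{for all } i\ge 2.$$ If, moreover, $t^B_1(I)\le\operatorname{end}(B/I)+1$, then $$t^C_i(k)\le(\operatorname{end}(B/I)+1)\,i-1\quad\text{for all } i\ge 2.$$ -/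

import Mathlib

open DirectSum TensorProduct

universe u v w

noncomputable section

/-! ### The end of a graded module -/

/-- The end of a graded module `X = ⨁ d, X d`: the largest degree in which it is nonzero, with
value `⊤ = ∞` if it is nonzero in arbitrarily large degrees and `⊥ = -∞` if it is zero. -/
def gradedEnd (X : ℕ → Type*) : EReal :=
  ⨆ (d : ℕ) (_ : Nontrivial (X d)), (d : EReal)

/-! ### Gradings on subobjects and quotients -/

section SubQuotient

variable {k : Type w} [CommRing k]

/-- The grading induced on a `k`-submodule `W` of a graded `k`-module. -/
def subGrading {M : Type u} [AddCommGroup M] [Module k M] (ℳ : ℕ → Submodule k M)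
    (W : Submodule k M) (d : ℕ) : Submodule k W :=
  (ℳ d).comap W.subtype

/-- A homogeneous submodule is the direct sum of its homogeneous components. -/
abbrev subDecomposition {M : Type u} [AddCommGroup M] [Module k M] (ℳ : ℕ → Submodule k M)
    [Decomposition ℳ] (W : Submodule k M) (hW : SetLike.IsHomogeneous ℳ W) :
    Decomposition (subGrading ℳ W) :=
  IsInternal.chooseDecomposition _ <| by
    classical
    have key : ∀ y : ⨁ d, subGrading ℳ W d, ∀ d,
        (decompose ℳ ((DirectSum.coeAddMonoidHom (subGrading ℳ W) y : W) : M) d : M)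
          = ((y d : W) : M) := by
      intro y d
      induction y using DirectSum.induction_on with
      | zero => simp
      | of i x =>
        rw [DirectSum.coeAddMonoidHom_of]
        have hx : ((x : W) : M) ∈ ℳ i := x.2
        by_cases h : i = d
        · subst h
          rw [decompose_of_mem_same ℳ hx]; simp
        · rw [decompose_of_mem_ne ℳ hx h, DirectSum.of_eq_of_ne _ _ _ (Ne.symm h)]; simp
      | add x y hx hy =>
        simp only [map_add, Submodule.coe_add, decompose_add, DirectSum.add_apply, hx, hy]
    constructor
    · intro y z hyz
      refine DFinsupp.ext fun d => Subtype.ext (Subtype.ext ?_)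
      have := key y d
      rw [hyz, key z d] at this
      exact this.symm
    · intro x
      refine ⟨∑ d ∈ (decompose ℳ (x : M)).support, DirectSum.of (fun d => subGrading ℳ W d) d
        ⟨⟨(decompose ℳ (x : M) d : M), hW d x.2⟩, (decompose ℳ (x : M) d).2⟩, ?_⟩
      apply Subtype.ext
      rw [map_sum]
      simp only [DirectSum.coeAddMonoidHom_of, Submodule.coe_sum]
      exact sum_support_decompose ℳ (x : M)

variable {A : Type u} [CommRing A] [Algebra k A] {𝒜 : ℕ → Submodule k A} [GradedAlgebra 𝒜]

namespace HomogeneousIdeal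

/-- The grading `I_d = I ∩ A_d` of a homogeneous ideal `I ⊆ A`. -/
def grading (I : HomogeneousIdeal 𝒜) (d : ℕ) : Submodule k I.toIdeal :=
  subGrading 𝒜 (I.toIdeal.restrictScalars k) d

instance (I : HomogeneousIdeal 𝒜) : Decomposition I.grading :=
  subDecomposition 𝒜 (I.toIdeal.restrictScalars k) I.isHomogeneous

instance (I : HomogeneousIdeal 𝒜) : SetLike.GradedSMul 𝒜 I.grading where
  smul_mem {_ _ _ b} ha hb := SetLike.GradedMul.mul_mem (A := 𝒜) ha (show (b : A) ∈ 𝒜 _ from hb)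

/-- The grading of `A ⧸ I` whose degree `d` part is the image of `A_d`. -/
def quotientGrading (I : HomogeneousIdeal 𝒜) (d : ℕ) : Submodule k (A ⧸ I.toIdeal) :=
  (𝒜 d).map (Ideal.Quotient.mkₐ k I.toIdeal).toLinearMap

instance (I : HomogeneousIdeal 𝒜) : Decomposition I.quotientGrading :=
  IsInternal.chooseDecomposition _ <| by
    classical
    have lift : ∀ y : ⨁ d, I.quotientGrading d, ∃ a : A,
        Ideal.Quotient.mk I.toIdeal a = DirectSum.coeAddMonoidHom I.quotientGrading y ∧
        ∀ d, Ideal.Quotient.mk I.toIdeal (decompose 𝒜 a d : A) = y d := by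
      intro y
      induction y using DirectSum.induction_on with
      | zero => exact ⟨0, by simp, by simp⟩
      | of i x =>
        obtain ⟨x, a, ha, rfl⟩ := x
        refine ⟨a, by simp, fun d => ?_⟩
        by_cases h : i = d
        · subst h
          rw [decompose_of_mem_same 𝒜 ha]; simp
        · rw [decompose_of_mem_ne 𝒜 ha h, DirectSum.of_eq_of_ne _ _ _ (Ne.symm h)]; simp
      | add x y hx hy =>
        obtain ⟨a, ha, ha'⟩ := hx
        obtain ⟨b, hb, hb'⟩ := hy
        exact ⟨a + b, by simp [ha, hb], fun d => by simp [decompose_add, ha', hb']⟩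
    constructor
    · rw [injective_iff_map_eq_zero]
      intro y hy
      obtain ⟨a, ha, ha'⟩ := lift y
      rw [hy, Ideal.Quotient.eq_zero_iff_mem] at ha
      refine DFinsupp.ext fun d => Subtype.ext ?_
      rw [← ha' d]
      exact Ideal.Quotient.eq_zero_iff_mem.mpr (I.isHomogeneous d ha)
    · intro x
      obtain ⟨a, rfl⟩ := Ideal.Quotient.mk_surjective x
      refine ⟨∑ d ∈ (decompose 𝒜 a).support, DirectSum.of (fun d => I.quotientGrading d) d
        ⟨Ideal.Quotient.mk _ (decompose 𝒜 a d : A), _, (decompose 𝒜 a d).2, rfl⟩, ?_⟩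
      rw [map_sum]
      simp only [DirectSum.coeAddMonoidHom_of]
      rw [← map_sum, sum_support_decompose 𝒜 a]

instance (I : HomogeneousIdeal 𝒜) : SetLike.GradedSMul 𝒜 I.quotientGrading where
  smul_mem {_ _ a b} ha hb := by
    obtain ⟨b, hb, rfl⟩ := hb
    exact ⟨a * b, SetLike.GradedMul.mul_mem ha hb, rfl⟩

end HomogeneousIdeal

/-- The residue module `A ⧸ A₊`. It is `k`, concentrated in degree `0`, when `A_0 = k`. -/
abbrev ResidueModule (𝒜 : ℕ → Submodule k A) [GradedAlgebra 𝒜] : Type u :=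
  A ⧸ (HomogeneousIdeal.irrelevant 𝒜).toIdeal

/-- The grading of the residue module `A ⧸ A₊`. -/
abbrev residueGrading (𝒜 : ℕ → Submodule k A) [GradedAlgebra 𝒜] :
    ℕ → Submodule k (ResidueModule 𝒜) :=
  (HomogeneousIdeal.irrelevant 𝒜).quotientGrading

/-- A graded subalgebra: a subalgebra that contains the homogeneous components of its elements. -/
structure HomogeneousSubalgebra (𝒜 : ℕ → Submodule k A) [GradedAlgebra 𝒜]
    extends Subalgebra k A where
  isHomogeneous' : SetLike.IsHomogeneous 𝒜 toSubalgebra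

namespace HomogeneousSubalgebra

variable (C : HomogeneousSubalgebra 𝒜)

/-- The grading `C_d = C ∩ A_d` of a graded subalgebra `C ⊆ A`. -/
def grading (d : ℕ) : Submodule k C.toSubalgebra :=
  subGrading 𝒜 (Subalgebra.toSubmodule C.toSubalgebra) d

instance : GradedAlgebra C.grading where
  one_mem := SetLike.GradedOne.one_mem (A := 𝒜)
  mul_mem _ _ a b ha hb := SetLike.GradedMul.mul_mem (A := 𝒜)
    (show (a : A) ∈ 𝒜 _ from ha) (show (b : A) ∈ 𝒜 _ from hb)
  toDecomposition :=
    subDecomposition 𝒜 (Subalgebra.toSubmodule C.toSubalgebra) C.isHomogeneous'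

/-- The inclusion `C → A` as a homomorphism of graded rings. -/
def inclusion : C.grading →+*ᵍ 𝒜 where
  toRingHom := C.toSubalgebra.val.toRingHom
  map_mem h := h

/-- The ideal `C₊ A` of `A`. -/
def extendedIrrelevant : HomogeneousIdeal 𝒜 :=
  (HomogeneousIdeal.irrelevant C.grading).map C.inclusion

/-- The inclusion `C → A` is split: it has a `C`-linear left inverse. -/
def IsSplit : Prop :=
  ∃ π : A →ₗ[C.toSubalgebra] C.toSubalgebra, ∀ c : C.toSubalgebra, π (c : A) = c

end HomogeneousSubalgebra

end SubQuotient

/-! ### Graded free modules -/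

section Free

variable {k : Type w} [CommRing k] {A : Type u} [CommRing A] [Algebra k A]
variable (𝒜 : ℕ → Submodule k A)

/-- The degree `n` part `A(-s)_n = A_{n-s}` of the free module `A(-s)` on a generator of
degree `s`. -/
def twist (s n : ℕ) : Submodule k A :=
  if s ≤ n then 𝒜 (n - s) else ⊥

/-- The degree `n` part of the free module on basis elements `c : ι` of degrees `deg c`. -/
def freeGrading {ι : Type v} (deg : ι → ℕ) (n : ℕ) : Submodule k (ι →₀ A) where
  carrier := {x | ∀ c, x c ∈ twist 𝒜 (deg c) n}
  add_mem' hx hy c := add_mem (hx c) (hy c)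
  zero_mem' _ := zero_mem _
  smul_mem' r _ hx c := Submodule.smul_mem _ r (hx c)

/-- The degree `n` part of a free module `P` with a basis of homogeneous elements `b c` of degrees
`deg c`: the elements all of whose coordinates with respect to `b c` have degree `n - deg c`. -/
def basisGrading {P : Type u} [AddCommGroup P] [Module k P] [Module A P] [IsScalarTower k A P]
    {ι : Type v} (b : Module.Basis ι A P) (deg : ι → ℕ) (n : ℕ) : Submodule k P :=
  (freeGrading 𝒜 deg n).comap (b.repr.toLinearMap.restrictScalars k)

variable {𝒜}

theorem single_mem_freeGrading {ι : Type v} (deg : ι → ℕ) (c : ι) {m : ℕ} {a : A}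
    (ha : a ∈ 𝒜 m) : Finsupp.single c a ∈ freeGrading 𝒜 deg (m + deg c) := by
  classical
  intro c'
  by_cases h : c = c'
  · subst h
    simpa [twist] using ha
  · rw [Finsupp.single_eq_of_ne (Ne.symm h)]
    exact zero_mem _

/-- A linear map from a graded free module preserves degree if it does so on the basis. -/
theorem linearCombination_mem [GradedAlgebra 𝒜] {ι : Type v} (deg : ι → ℕ) {M : Type u}
    [AddCommGroup M] [Module k M] [Module A M] (ℳ : ℕ → Submodule k M) [SetLike.GradedSMul 𝒜 ℳ]
    (f : ι → M) (hf : ∀ c, f c ∈ ℳ (deg c)) {n : ℕ} {x : ι →₀ A}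
    (hx : x ∈ freeGrading 𝒜 deg n) : Finsupp.linearCombination A f x ∈ ℳ n := by
  rw [Finsupp.linearCombination_apply, Finsupp.sum]
  refine sum_mem fun c _ => ?_
  have hc := hx c
  unfold twist at hc
  split_ifs at hc with h
  · have := SetLike.GradedSMul.smul_mem (A := 𝒜) (B := ℳ) hc (hf c)
    rwa [vadd_eq_add, Nat.sub_add_cancel h] at this
  · rw [(Submodule.mem_bot k).mp hc, zero_smul]
    exact zero_mem _

instance [GradedAlgebra 𝒜] {ι : Type v} (deg : ι → ℕ) :
    SetLike.GradedSMul 𝒜 (freeGrading 𝒜 deg) where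
  smul_mem {i n a x} ha hx c := by
    have hc := hx c
    simp only [twist, Finsupp.smul_apply, smul_eq_mul, vadd_eq_add] at hc ⊢
    by_cases h : deg c ≤ n
    · rw [if_pos h] at hc
      rw [if_pos (h.trans (Nat.le_add_left _ _)), Nat.add_sub_assoc h]
      exact SetLike.GradedMul.mul_mem ha hc
    · rw [if_neg h, Submodule.mem_bot] at hc
      rw [hc, mul_zero]
      exact zero_mem _

instance [GradedAlgebra 𝒜] {ι : Type v} (deg : ι → ℕ) : Decomposition (freeGrading 𝒜 deg) :=
  IsInternal.chooseDecomposition _ <| by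
    classical
    constructor
    · -- coordinatewise, the degree `n` part is a homogeneous component
      have key : ∀ y : ⨁ n, freeGrading 𝒜 deg n, ∀ n c, deg c ≤ n →
          (decompose 𝒜 ((DirectSum.coeAddMonoidHom (freeGrading 𝒜 deg) y) c) (n - deg c) : A)
            = (y n : ι →₀ A) c := by
        intro y n c hc
        induction y using DirectSum.induction_on with
        | zero => simp
        | of i x =>
          rw [DirectSum.coeAddMonoidHom_of]
          have hx := x.2 c
          unfold twist at hx
          by_cases h : i = n
          · subst h
            rw [if_pos hc] at hx
            rw [decompose_of_mem_same 𝒜 hx, DirectSum.of_eq_same]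
          · rw [DirectSum.of_eq_of_ne _ _ _ (Ne.symm h)]
            split_ifs at hx with h'
            · rw [decompose_of_mem_ne 𝒜 hx (by omega)]; simp
            · rw [(Submodule.mem_bot k).mp hx]; simp
        | add x y hx hy =>
          simp only [map_add, Finsupp.add_apply, decompose_add, DirectSum.add_apply,
            Submodule.coe_add, hx, hy]
      intro y z hyz
      refine DFinsupp.ext fun n => Subtype.ext (Finsupp.ext fun c => ?_)
      by_cases hc : deg c ≤ n
      · rw [← key y n c hc, hyz, key z n c hc]
      · have hy := (y n).2 c
        have hz := (z n).2 c
        unfold twist at hy hz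
        rw [if_neg hc, Submodule.mem_bot] at hy hz
        rw [hy, hz]
    · intro x
      induction x using Finsupp.induction_linear with
      | zero => exact ⟨0, map_zero _⟩
      | add x y hx hy =>
        obtain ⟨x, rfl⟩ := hx
        obtain ⟨y, rfl⟩ := hy
        exact ⟨x + y, map_add _ _ _⟩
      | single c a =>
        induction a using Decomposition.inductionOn 𝒜 with
        | zero => exact ⟨0, by simp⟩
        | homogeneous a =>
          exact ⟨DirectSum.of (fun n => freeGrading 𝒜 deg n) _
            ⟨_, single_mem_freeGrading deg c a.2⟩, by rw [DirectSum.coeAddMonoidHom_of]⟩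
        | add a b ha hb =>
          obtain ⟨x, hx⟩ := ha
          obtain ⟨y, hy⟩ := hb
          exact ⟨x + y, by rw [map_add, hx, hy, Finsupp.single_add]⟩

end Free

/-! ### Graded free resolutions -/

section Resolution

variable {k : Type w} [CommRing k] {A M : Type u} [CommRing A] [Algebra k A]
variable [AddCommGroup M] [Module k M] [Module A M]

/-- A graded free resolution `⋯ → F₁ → F₀ → M → 0` of the graded `A`-module `M`: each `F i` is
free on homogeneous basis elements of degrees `deg i c`, and all maps preserve degree. -/
structure GradedFreeResolution (𝒜 : ℕ → Submodule k A) (ℳ : ℕ → Submodule k M) where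
  /-- the terms of the resolution -/
  F : ℕ → Type u
  [addCommGroup : ∀ i, AddCommGroup (F i)]
  [moduleBase : ∀ i, Module k (F i)]
  [module : ∀ i, Module A (F i)]
  [isScalarTower : ∀ i, IsScalarTower k A (F i)]
  /-- the index set of the basis of `F i` -/
  ι : ℕ → Type u
  /-- the basis of `F i` -/
  basis : ∀ i, Module.Basis (ι i) A (F i)
  /-- the degrees of the basis elements -/
  deg : ∀ i, ι i → ℕ
  /-- the differential -/
  d : ∀ i, F (i + 1) →ₗ[A] F i
  /-- the augmentation -/
  aug : F 0 →ₗ[A] M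
  d_mem : ∀ i n, ∀ x ∈ basisGrading 𝒜 (basis (i + 1)) (deg (i + 1)) n,
    d i x ∈ basisGrading 𝒜 (basis i) (deg i) n
  aug_mem : ∀ n, ∀ x ∈ basisGrading 𝒜 (basis 0) (deg 0) n, aug x ∈ ℳ n
  exact_d : ∀ i, Function.Exact (d (i + 1)) (d i)
  exact_aug : Function.Exact (d 0) aug
  aug_surjective : Function.Surjective aug

attribute [instance] GradedFreeResolution.addCommGroup GradedFreeResolution.moduleBase
  GradedFreeResolution.module GradedFreeResolution.isScalarTower

/-- The kernel of a degree preserving map is homogeneous. -/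
theorem isHomogeneous_ker {P : Type u} [AddCommGroup P] [Module k P] [Module A P]
    (𝒟 : ℕ → Submodule k P) [Decomposition 𝒟] (ℳ : ℕ → Submodule k M) [Decomposition ℳ]
    (φ : P →ₗ[A] M) (hφ : ∀ n, ∀ x ∈ 𝒟 n, φ x ∈ ℳ n) :
    (LinearMap.ker φ).IsHomogeneous 𝒟 := by
  have key : ∀ x n, φ (decompose 𝒟 x n : P) = (decompose ℳ (φ x) n : M) := by
    intro x n
    induction x using Decomposition.inductionOn 𝒟 with
    | zero => simp
    | @homogeneous i x =>
      by_cases h : i = n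
      · subst h
        rw [decompose_of_mem_same 𝒟 x.2, decompose_of_mem_same ℳ (hφ _ _ x.2)]
      · rw [decompose_of_mem_ne 𝒟 x.2 h, decompose_of_mem_ne ℳ (hφ _ _ x.2) h, map_zero]
    | add x y hx hy =>
      simp only [decompose_add, DirectSum.add_apply, Submodule.coe_add, map_add, hx, hy]
  intro n x hx
  rw [LinearMap.mem_ker] at hx ⊢
  rw [key, hx]
  simp

/-- The homogeneous elements of a submodule, together with their degrees. -/
def HomogeneousElements (ℳ : ℕ → Submodule k M) (N : Submodule A M) : Type u :=
  {p : ULift.{u} ℕ × M // p.2 ∈ N ∧ p.2 ∈ ℳ p.1.down}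

/-- The map to `M` from the free module on the homogeneous elements of a submodule. -/
def coverMap (ℳ : ℕ → Submodule k M) (N : Submodule A M) :
    (HomogeneousElements ℳ N →₀ A) →ₗ[A] M :=
  Finsupp.linearCombination A fun p => p.1.2

theorem coverMap_mem (𝒜 : ℕ → Submodule k A) [GradedAlgebra 𝒜] (ℳ : ℕ → Submodule k M)
    [SetLike.GradedSMul 𝒜 ℳ] (N : Submodule A M) (n : ℕ) :
    ∀ x ∈ freeGrading 𝒜 (fun p : HomogeneousElements ℳ N => p.1.1.down) n,
      coverMap ℳ N x ∈ ℳ n :=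
  fun _ hx => linearCombination_mem _ ℳ _ (fun p => p.2.2) hx

theorem range_coverMap (ℳ : ℕ → Submodule k M) [Decomposition ℳ] (N : Submodule A M)
    (hN : N.IsHomogeneous ℳ) : LinearMap.range (coverMap ℳ N) = N := by
  classical
  rw [coverMap, Finsupp.range_linearCombination]
  apply le_antisymm
  · rw [Submodule.span_le]
    rintro _ ⟨p, rfl⟩
    exact p.2.1
  · intro x hx
    rw [← sum_support_decompose ℳ x]
    refine sum_mem fun n _ => Submodule.subset_span ?_
    exact ⟨⟨(⟨n⟩, _), hN n hx, (decompose ℳ x n).2⟩, rfl⟩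

/-- A graded free module with a homogeneous submodule that remains to be covered. -/
structure ResolutionStage (𝒜 : ℕ → Submodule k A) [GradedAlgebra 𝒜] where
  ι : Type u
  deg : ι → ℕ
  N : Submodule A (ι →₀ A)
  hN : N.IsHomogeneous (freeGrading 𝒜 deg)

/-- Cover the given submodule by a graded free module and pass to the kernel. -/
def ResolutionStage.next {𝒜 : ℕ → Submodule k A} [GradedAlgebra 𝒜] (S : ResolutionStage 𝒜) :
    ResolutionStage 𝒜 where
  ι := HomogeneousElements (freeGrading 𝒜 S.deg) S.N
  deg p := p.1.1.down
  N := LinearMap.ker (coverMap (freeGrading 𝒜 S.deg) S.N)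
  hN := isHomogeneous_ker _ _ _ (coverMap_mem 𝒜 _ S.N)

/-- The differential that covers the given submodule. -/
def ResolutionStage.map {𝒜 : ℕ → Submodule k A} [GradedAlgebra 𝒜] (S : ResolutionStage 𝒜) :
    (S.next.ι →₀ A) →ₗ[A] (S.ι →₀ A) :=
  coverMap (freeGrading 𝒜 S.deg) S.N

theorem ResolutionStage.range_map {𝒜 : ℕ → Submodule k A} [GradedAlgebra 𝒜]
    (S : ResolutionStage 𝒜) : LinearMap.range S.map = S.N :=
  range_coverMap _ _ S.hN

theorem ResolutionStage.exact_map {𝒜 : ℕ → Submodule k A} [GradedAlgebra 𝒜]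
    (S : ResolutionStage 𝒜) : Function.Exact S.next.map S.map :=
  LinearMap.exact_iff.mpr S.next.range_map.symm

/-- Every graded module has a graded free resolution. -/
theorem GradedFreeResolution.nonempty (𝒜 : ℕ → Submodule k A) [GradedAlgebra 𝒜]
    (ℳ : ℕ → Submodule k M) [Decomposition ℳ] [SetLike.GradedSMul 𝒜 ℳ] :
    Nonempty (GradedFreeResolution 𝒜 ℳ) := by
  let S₀ : ResolutionStage 𝒜 :=
    { ι := HomogeneousElements ℳ (⊤ : Submodule A M)
      deg := fun p => p.1.1.down
      N := LinearMap.ker (coverMap ℳ (⊤ : Submodule A M))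
      hN := isHomogeneous_ker _ _ _ (coverMap_mem 𝒜 ℳ _) }
  let S : ℕ → ResolutionStage 𝒜 := fun i => Nat.rec S₀ (fun _ T => T.next) i
  exact ⟨{
    F := fun i => (S i).ι →₀ A
    ι := fun i => (S i).ι
    basis := fun i => Finsupp.basisSingleOne
    deg := fun i => (S i).deg
    d := fun i => (S i).map
    aug := coverMap ℳ (⊤ : Submodule A M)
    d_mem := fun i n => coverMap_mem 𝒜 _ (S i).N n
    aug_mem := coverMap_mem 𝒜 ℳ _
    exact_d := fun i => (S i).exact_map
    exact_aug := LinearMap.exact_iff.mpr S₀.range_map.symm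
    aug_surjective := LinearMap.range_eq_top.mp (range_coverMap ℳ _ fun _ _ _ => trivial) }⟩

end Resolution

/-! ### Graded Tor -/

section Tor

variable {k : Type w} [CommRing k] {A M : Type u} [CommRing A] [Algebra k A]
variable [AddCommGroup M] [Module k M] [Module A M]

/-- The degree `n` part of `P ⊗[A] N`, spanned by the `x ⊗ y` with `x`, `y` homogeneous and
`deg x + deg y = n`. -/
def tensorGrading (A : Type u) [CommRing A] [Algebra k A] {P : Type u} [AddCommGroup P]
    [Module k P] [Module A P] [IsScalarTower k A P] {N : Type v} [AddCommGroup N] [Module k N]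
    [Module A N] (𝒟 : ℕ → Submodule k P) (𝒩 : ℕ → Submodule k N) (n : ℕ) :
    Submodule k (P ⊗[A] N) :=
  Submodule.span k {z | ∃ i j, i + j = n ∧ ∃ x ∈ 𝒟 i, ∃ y ∈ 𝒩 j, x ⊗ₜ[A] y = z}

namespace GradedFreeResolution

variable {𝒜 : ℕ → Submodule k A} {ℳ : ℕ → Submodule k M} (F : GradedFreeResolution 𝒜 ℳ)
variable {N : Type v} [AddCommGroup N] [Module k N] [Module A N] (𝒩 : ℕ → Submodule k N)

variable (N) in
/-- The cycles of the complex `F ⊗ N` in homological degree `i`. -/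
def cycles : ∀ i, Submodule A (F.F i ⊗[A] N)
  | 0 => ⊤
  | i + 1 => LinearMap.ker ((F.d i).rTensor N)

variable (N) in
/-- The boundaries of the complex `F ⊗ N` in homological degree `i`. -/
def boundaries (i : ℕ) : Submodule A (F.F i ⊗[A] N) :=
  LinearMap.range ((F.d i).rTensor N)

/-- The cycles of internal degree `n`. -/
def gradedCycles (i n : ℕ) : Submodule k (F.F i ⊗[A] N) :=
  (F.cycles N i).restrictScalars k ⊓ tensorGrading A (basisGrading 𝒜 (F.basis i) (F.deg i)) 𝒩 n

/-- The boundaries of internal degree `n`. -/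
def gradedBoundaries (i n : ℕ) : Submodule k (F.F i ⊗[A] N) :=
  (F.boundaries N i).restrictScalars k ⊓ tensorGrading A (basisGrading 𝒜 (F.basis i) (F.deg i)) 𝒩 n

/-- The degree `n` part of the homology `H_i(F ⊗ N)`. -/
abbrev Homology (i n : ℕ) : Type (max u v) :=
  F.gradedCycles 𝒩 i n ⧸ (F.gradedBoundaries 𝒩 i n).submoduleOf (F.gradedCycles 𝒩 i n)

end GradedFreeResolution

/-- The degree `n` part of the graded module `Tor_i^A(M, N)`, computed from a graded free
resolution of `M`. -/
abbrev GradedTor (𝒜 : ℕ → Submodule k A) [GradedAlgebra 𝒜] (ℳ : ℕ → Submodule k M)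
    [Decomposition ℳ] [SetLike.GradedSMul 𝒜 ℳ] {N : Type v} [AddCommGroup N] [Module k N]
    [Module A N] (𝒩 : ℕ → Submodule k N) (i n : ℕ) : Type (max u v) :=
  (GradedFreeResolution.nonempty 𝒜 ℳ).some.Homology 𝒩 i n

/-- `t_i^A(M)`, the end of the graded module `Tor_i^A(M, A ⧸ A₊)`. -/
def torEnd (𝒜 : ℕ → Submodule k A) [GradedAlgebra 𝒜] (ℳ : ℕ → Submodule k M)
    [Decomposition ℳ] [SetLike.GradedSMul 𝒜 ℳ] (i : ℕ) : EReal :=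
  gradedEnd fun n => GradedTor 𝒜 ℳ (residueGrading 𝒜) i n

end Tor

end

attribute [local instance] MvPolynomial.gradedAlgebra

/-! Let `F` be a graded free resolution of `k` over `C`, and extend it to a complex of free modules
over `B`. Its homology need not vanish, but it is killed by `C₊`, because multiplication by an
element of `C₊` is null-homotopic on `F`; hence `I` maps the cycles into the boundaries. The bounds
on the degrees of the cycles modulo boundaries and on the Koszul homology over `B` of the modules
of cycles propagate from one homological degree to the next, with `end (B/I)` controlling each
step. A `C`-linear splitting `π : B → C` may be taken of degree zero, and then carries the bounds
over `B` back to `Tor^C(k, k)`.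
-/

open scoped HomogeneousIdeal

noncomputable section

section Koszul

/-- The basis of the `j`-th term of the Koszul complex of `r` elements. The complex is built as an
iterated mapping cone: a basis element either omits the last of the `r` elements or involves it. -/
def KoszulIndex : ℕ → ℕ → Type
  | 0, 0 => Unit
  | 0, _ + 1 => Empty
  | r + 1, 0 => KoszulIndex r 0
  | r + 1, j + 1 => KoszulIndex r (j + 1) ⊕ KoszulIndex r j

namespace KoszulIndex

/-- A basis element in homological degree `0`, which omits the last of `r + 1` elements. -/
def base {r : ℕ} (s : KoszulIndex r 0) : KoszulIndex (r + 1) 0 := s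

/-- A basis element that omits the last of `r + 1` elements. -/
def omitLast {r j : ℕ} (s : KoszulIndex r (j + 1)) : KoszulIndex (r + 1) (j + 1) := Sum.inl s

/-- A basis element that involves the last of `r + 1` elements. -/
def withLast {r j : ℕ} (s : KoszulIndex r j) : KoszulIndex (r + 1) (j + 1) := Sum.inr s

@[elab_as_elim]
theorem forall_zero {r : ℕ} {p : KoszulIndex (r + 1) 0 → Prop} (h : ∀ s, p (base s)) (s) : p s :=
  h s

@[elab_as_elim]
theorem forall_succ {r j : ℕ} {p : KoszulIndex (r + 1) (j + 1) → Prop}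
    (omitLast : ∀ s, p (omitLast s)) (withLast : ∀ s, p (withLast s)) (s) : p s :=
  Sum.rec omitLast withLast s

instance nonempty_zero : ∀ r, Nonempty (KoszulIndex r 0)
  | 0 => ⟨()⟩
  | r + 1 => nonempty_zero r

instance finite : ∀ r j, Finite (KoszulIndex r j)
  | 0, 0 => inferInstanceAs (Finite Unit)
  | 0, _ + 1 => inferInstanceAs (Finite Empty)
  | r + 1, 0 => finite r 0
  | r + 1, j + 1 =>
    have := finite r (j + 1)
    have := finite r j
    inferInstanceAs (Finite (KoszulIndex r (j + 1) ⊕ KoszulIndex r j))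

end KoszulIndex

open KoszulIndex

variable {R : Type*} [CommRing R] (x : ℕ → R)
variable {M M' : Type*} [AddCommGroup M] [Module R M] [AddCommGroup M'] [Module R M']

/-- The Koszul differential of `x 0, …, x (r - 1)` with coefficients in `M`. -/
def koszulD : ∀ r j : ℕ, (KoszulIndex r (j + 1) → M) →ₗ[R] (KoszulIndex r j → M)
  | 0, _ => 0
  | r + 1, 0 => koszulD r 0 ∘ₗ LinearMap.funLeft R M omitLast +
      x r • LinearMap.funLeft R M withLast
  | r + 1, j + 1 => LinearMap.pi <| Sum.elim
      (fun s => LinearMap.proj s ∘ₗ (koszulD r (j + 1) ∘ₗ LinearMap.funLeft R M omitLast +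
        x r • LinearMap.funLeft R M withLast))
      (fun s => - (LinearMap.proj s ∘ₗ koszulD r j ∘ₗ LinearMap.funLeft R M withLast))

theorem koszulD_base (r : ℕ) (f : KoszulIndex (r + 1) 1 → M) (s : KoszulIndex r 0) :
    koszulD x (r + 1) 0 f (base s) =
      koszulD x r 0 (f ∘ omitLast) s + x r • f (withLast s) := rfl

theorem koszulD_omitLast (r j : ℕ) (f : KoszulIndex (r + 1) (j + 2) → M)
    (s : KoszulIndex r (j + 1)) : koszulD x (r + 1) (j + 1) f (omitLast s) =
      koszulD x r (j + 1) (f ∘ omitLast) s + x r • f (withLast s) := rfl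

theorem koszulD_withLast (r j : ℕ) (f : KoszulIndex (r + 1) (j + 2) → M) (s : KoszulIndex r j) :
    koszulD x (r + 1) (j + 1) f (withLast s) = - koszulD x r j (f ∘ withLast) s := rfl

/-- Two maps instead of one linear map, so that naturality also covers maps that shift degree, such
as homogeneous components. -/
theorem map_koszulD_apply (φ ψ : M →+ M') (h : ∀ i m, φ (x i • m) = x i • ψ m) :
    ∀ (r j : ℕ) (f : KoszulIndex r (j + 1) → M) (s),
      φ (koszulD x r j f s) = koszulD x r j (ψ ∘ f) s
  | 0, _, _, _ => map_zero φ
  | r + 1, 0, f, s => by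
    refine forall_zero (fun s => ?_) s
    rw [koszulD_base, koszulD_base, map_add, h, map_koszulD_apply φ ψ h r 0]
    rfl
  | r + 1, j + 1, f, s => by
    refine forall_succ (fun s => ?_) (fun s => ?_) s
    · rw [koszulD_omitLast, koszulD_omitLast, map_add, h, map_koszulD_apply φ ψ h r (j + 1)]
      rfl
    · rw [koszulD_withLast, koszulD_withLast, map_neg, map_koszulD_apply φ ψ h r j]
      rfl

theorem koszulD_comp_linearMap (φ : M →ₗ[R] M') (r j : ℕ) (f : KoszulIndex r (j + 1) → M) :
    koszulD x r j (φ ∘ f) = φ ∘ koszulD x r j f :=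
  funext fun s => (map_koszulD_apply x φ.toAddMonoidHom φ.toAddMonoidHom
    (fun i m => φ.map_smul (x i) m) r j f s).symm

theorem koszulD_mem (N : AddSubgroup M) :
    ∀ (r j : ℕ) (f : KoszulIndex r (j + 1) → M), (∀ i < r, ∀ s, x i • f s ∈ N) →
      ∀ s, koszulD x r j f s ∈ N
  | 0, _, _, _, _ => zero_mem N
  | r + 1, 0, f, h, s => add_mem
      (koszulD_mem N r 0 _ (fun i hi t => h i (by omega) (omitLast t)) s)
      (h r (by omega) (withLast s))
  | r + 1, j + 1, f, h, .inl s => add_mem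
      (koszulD_mem N r (j + 1) _ (fun i hi t => h i (by omega) (omitLast t)) s)
      (h r (by omega) (withLast s))
  | r + 1, j + 1, f, h, .inr s => neg_mem
      (koszulD_mem N r j _ (fun i hi t => h i (by omega) (withLast t)) s)

theorem koszulD_koszulD : ∀ (r j : ℕ) (f : KoszulIndex r (j + 2) → M),
    koszulD x r j (koszulD x r (j + 1) f) = 0
  | 0, _, _ => rfl
  | r + 1, j, f => by
    have h_omitLast (s : KoszulIndex r j) :
        koszulD x r j (koszulD x (r + 1) (j + 1) f ∘ omitLast) s +
          x r • koszulD x (r + 1) (j + 1) f (withLast s) = 0 := by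
      have h : koszulD x (r + 1) (j + 1) f ∘ omitLast =
        koszulD x r (j + 1) (f ∘ omitLast) + x r • (f ∘ withLast) := rfl
      rw [h, map_add, map_smul, koszulD_koszulD r j, koszulD_withLast, zero_add, Pi.smul_apply,
        smul_neg, add_neg_cancel]
    funext s
    cases j with
    | zero => exact forall_zero h_omitLast s
    | succ j =>
      refine forall_succ h_omitLast (fun s => ?_) s
      have h : koszulD x (r + 1) (j + 2) f ∘ withLast = - koszulD x r (j + 1) (f ∘ withLast) := rfl
      rw [koszulD_withLast, h, map_neg, koszulD_koszulD r j, neg_zero]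
      exact neg_zero

variable (J : ℕ → AddSubgroup M) {m : ℕ} (hJ_zero : J 0 = ⊥)
  (hJ_succ : ∀ r < m, ∀ y ∈ J (r + 1), ∃ q ∈ J r, ∃ p, y = q + x r • p)

include hJ_zero hJ_succ in
theorem exists_koszulD_zero_eq {r : ℕ} (hr : r ≤ m) (f : KoszulIndex r 0 → M)
    (hf : ∀ s, f s ∈ J r) : ∃ g, koszulD x r 0 g = f := by
  induction r with
  | zero => exact ⟨0, funext fun s => ((AddSubgroup.mem_bot.mp (hJ_zero ▸ hf s))).symm⟩
  | succ r ih =>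
    choose q hq p hp using fun s => hJ_succ r hr (f s) (hf s)
    obtain ⟨g, hg⟩ := ih (by omega) q hq
    exact ⟨Sum.elim g p, funext fun s => (congrArg (· + x r • p s) (congrFun hg s)).trans
      (hp s).symm⟩

include hJ_zero hJ_succ in
/-- `J r` plays the role of `(x 0, …, x (r - 1)) M`. -/
theorem exact_koszulD (hJ_reg : ∀ r < m, ∀ y, x r • y ∈ J r → y ∈ J r)
    (hJ_smul : ∀ r ≤ m, ∀ i < r, ∀ y, x i • y ∈ J r) {r : ℕ} (hr : r ≤ m) (j : ℕ)
    (f : KoszulIndex r (j + 1) → M) (hf : koszulD x r j f = 0) :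
    ∃ g, koszulD x r (j + 1) g = f := by
  induction r generalizing j with
  | zero => exact ⟨0, funext fun s => s.elim⟩
  | succ r ih =>
    obtain ⟨b, hb⟩ : ∃ b, koszulD x r j b = f ∘ withLast := by
      cases j with
      | zero =>
        refine exists_koszulD_zero_eq x J hJ_zero hJ_succ (by omega) _ fun s => hJ_reg r hr _ ?_
        have := congrFun hf (base s)
        rw [koszulD_base] at this
        rw [Function.comp_apply, eq_neg_of_add_eq_zero_right this]
        exact neg_mem (koszulD_mem x (J r) r 0 _ (fun i hi t => hJ_smul r (by omega) i hi _) s)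
      | succ j =>
        exact ih (by omega) j _ (funext fun s => neg_eq_zero.mp (congrFun hf (withLast s)))
    have h_cycle : koszulD x r j (f ∘ omitLast + x r • b) = 0 := by
      funext s
      rw [map_add, map_smul, hb]
      cases j with
      | zero => exact congrFun hf (base s)
      | succ j => exact congrFun hf (omitLast s)
    obtain ⟨a, ha⟩ := ih (by omega) j _ h_cycle
    refine ⟨Sum.elim a (-b), funext fun s => forall_succ (fun s => ?_) (fun s => ?_) s⟩
    · change koszulD x r (j + 1) a s + x r • (- b s) = _
      rw [ha, smul_neg]
      exact add_neg_cancel_right _ _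
    · change - koszulD x r j (- b) s = _
      rw [map_neg, hb]
      exact neg_neg _

end Koszul

section Component

variable {k : Type*} [CommRing k] {M M' : Type*} [AddCommGroup M] [Module k M]
variable [AddCommGroup M'] [Module k M']

/-- The projection of a graded module to its degree `d` part. -/
def homogeneousPart (ℳ : ℕ → Submodule k M) [Decomposition ℳ] (d : ℕ) : M →+ M where
  toFun m := decompose ℳ m d
  map_zero' := by rw [decompose_zero, DirectSum.zero_apply, ZeroMemClass.coe_zero]
  map_add' x y := by rw [decompose_add, DirectSum.add_apply, Submodule.coe_add]

variable (ℳ : ℕ → Submodule k M) [Decomposition ℳ] (ℳ' : ℕ → Submodule k M') [Decomposition ℳ']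

theorem homogeneousPart_mem (d : ℕ) (m : M) : homogeneousPart ℳ d m ∈ ℳ d := (decompose ℳ m d).2

theorem homogeneousPart_of_mem {d : ℕ} {m : M} (hm : m ∈ ℳ d) : homogeneousPart ℳ d m = m :=
  decompose_of_mem_same ℳ hm

theorem homogeneousPart_of_mem_ne {d d' : ℕ} {m : M} (hm : m ∈ ℳ d) (h : d ≠ d') :
    homogeneousPart ℳ d' m = 0 :=
  decompose_of_mem_ne ℳ hm h

theorem map_homogeneousPart_add (φ : M →+ M') (j : ℕ) (hφ : ∀ n, ∀ x ∈ ℳ n, φ x ∈ ℳ' (j + n))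
    (d : ℕ) (x : M) : φ (homogeneousPart ℳ d x) = homogeneousPart ℳ' (j + d) (φ x) := by
  induction x using Decomposition.inductionOn ℳ with
  | zero => simp only [map_zero]
  | @homogeneous i x =>
    by_cases h : i = d
    · subst h
      rw [homogeneousPart_of_mem ℳ x.2, homogeneousPart_of_mem ℳ' (hφ _ _ x.2)]
    · rw [homogeneousPart_of_mem_ne ℳ x.2 h, homogeneousPart_of_mem_ne ℳ' (hφ _ _ x.2) (by omega),
        map_zero]
  | add x y hx hy => simp only [map_add, hx, hy]

theorem map_homogeneousPart (φ : M →+ M') (hφ : ∀ n, ∀ x ∈ ℳ n, φ x ∈ ℳ' n) (d : ℕ) (x : M) :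
    φ (homogeneousPart ℳ d x) = homogeneousPart ℳ' d (φ x) := by
  have := map_homogeneousPart_add ℳ ℳ' φ 0 (by simpa only [zero_add] using hφ) d x
  rwa [zero_add] at this

variable {A : Type*} [CommRing A] [Module A M] [Module A M']

theorem isHomogeneous_top : (⊤ : Submodule A M).IsHomogeneous ℳ := fun _ _ _ => trivial

section DegreePreserving

variable (φ : M →ₗ[A] M') (hφ : ∀ n, ∀ x ∈ ℳ n, φ x ∈ ℳ' n)
include hφ

theorem isHomogeneous_range : (LinearMap.range φ).IsHomogeneous ℳ' := by
  rintro d _ ⟨x, rfl⟩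
  exact ⟨homogeneousPart ℳ d x, map_homogeneousPart ℳ ℳ' φ.toAddMonoidHom hφ d x⟩

theorem exists_mem_of_mem_range {d : ℕ} {y : M'} (hy : y ∈ LinearMap.range φ) (hyd : y ∈ ℳ' d) :
    ∃ x ∈ ℳ d, φ x = y := by
  obtain ⟨x, rfl⟩ := hy
  refine ⟨homogeneousPart ℳ d x, homogeneousPart_mem ℳ d x, ?_⟩
  rw [← homogeneousPart_of_mem ℳ' hyd]
  exact map_homogeneousPart ℳ ℳ' φ.toAddMonoidHom hφ d x

end DegreePreserving

variable [Algebra k A] (𝒜 : ℕ → Submodule k A)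

theorem homogeneousPart_smul [SetLike.GradedSMul 𝒜 ℳ] {j : ℕ} {a : A} (ha : a ∈ 𝒜 j)
    (d : ℕ) (x : M) : homogeneousPart ℳ (j + d) (a • x) = a • homogeneousPart ℳ d x :=
  (map_homogeneousPart_add ℳ ℳ (DistribSMul.toAddMonoidHom M a) j
    (fun _ _ hx => SetLike.GradedSMul.smul_mem ha hx) d x).symm

theorem exists_degreePreserving [Decomposition 𝒜] [SetLike.GradedSMul 𝒜 ℳ]
    [SetLike.GradedSMul 𝒜 ℳ'] (φ : M →ₗ[A] M') :
    ∃ ψ : M →ₗ[A] M', ∀ d, ∀ x ∈ ℳ d, ψ x = homogeneousPart ℳ' d (φ x) := by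
  let ψ : M →+ M' := (DirectSum.toAddMonoid fun d => (homogeneousPart ℳ' d).comp
    (φ.toAddMonoidHom.comp (ℳ d).subtype.toAddMonoidHom)).comp (decomposeAddEquiv ℳ).toAddMonoidHom
  have hψ (d : ℕ) (x : M) (hx : x ∈ ℳ d) : ψ x = homogeneousPart ℳ' d (φ x) := by
    change DirectSum.toAddMonoid _ (decompose ℳ x) = _
    rw [decompose_of_mem ℳ hx, DirectSum.toAddMonoid_of]
    rfl
  refine ⟨{ ψ with map_smul' := fun a x => ?_ }, hψ⟩
  change ψ (a • x) = a • ψ x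
  induction a using Decomposition.inductionOn 𝒜 with
  | zero => simp only [zero_smul, map_zero]
  | add a b ha hb => rw [add_smul, map_add, ha, hb, add_smul]
  | @homogeneous i a =>
    induction x using Decomposition.inductionOn ℳ with
    | zero => simp only [smul_zero, map_zero]
    | add x y hx hy => rw [smul_add, map_add, hx, hy, map_add, smul_add]
    | @homogeneous d x =>
      rw [hψ d x x.2, hψ (i + d) _ (SetLike.GradedSMul.smul_mem a.2 x.2), map_smul,
        homogeneousPart_smul ℳ' 𝒜 a.2]

end Component

section Irrelevant

variable {k : Type*} [CommRing k] {A : Type*} [CommRing A] [Algebra k A]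
variable {𝒜 : ℕ → Submodule k A} [GradedAlgebra 𝒜]

theorem mem_irrelevant_iff_homogeneousPart {a : A} : a ∈ 𝒜₊.toIdeal ↔ homogeneousPart 𝒜 0 a = 0 :=
  HomogeneousIdeal.mem_irrelevant_iff 𝒜 a

theorem mem_irrelevant_of_mem {a : A} {d : ℕ} (hd : d ≠ 0) (ha : a ∈ 𝒜 d) : a ∈ 𝒜₊.toIdeal :=
  mem_irrelevant_iff_homogeneousPart.mpr (homogeneousPart_of_mem_ne 𝒜 ha hd)

theorem map_mem_irrelevant {A' : Type*} [CommRing A'] [Algebra k A'] {𝒜' : ℕ → Submodule k A'}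
    [GradedAlgebra 𝒜'] (φ : A →+ A') (hφ : ∀ d, ∀ a ∈ 𝒜 d, φ a ∈ 𝒜' d) {a : A}
    (ha : a ∈ 𝒜₊.toIdeal) : φ a ∈ 𝒜'₊.toIdeal := by
  rw [mem_irrelevant_iff_homogeneousPart] at ha ⊢
  rw [← map_homogeneousPart 𝒜 𝒜' φ hφ, ha, map_zero]

theorem map_irrelevant_le {A' : Type*} [CommRing A'] [Algebra k A'] {𝒜' : ℕ → Submodule k A'}
    [GradedAlgebra 𝒜'] [Algebra A A'] (h : ∀ d, ∀ a ∈ 𝒜 d, algebraMap A A' a ∈ 𝒜' d) :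
    𝒜₊.toIdeal.map (algebraMap A A') ≤ 𝒜'₊.toIdeal :=
  Ideal.map_le_iff_le_comap.mpr fun _ => map_mem_irrelevant (algebraMap A A').toAddMonoidHom h

variable (𝒜) in
theorem one_notMem_irrelevant [Nontrivial A] : (1 : A) ∉ 𝒜₊.toIdeal := by
  rw [mem_irrelevant_iff_homogeneousPart, homogeneousPart_of_mem 𝒜 SetLike.GradedOne.one_mem]
  exact one_ne_zero

instance (C : HomogeneousSubalgebra 𝒜) : SetLike.GradedSMul C.grading 𝒜 where
  smul_mem {_ _ c _} hc ha := SetLike.GradedMul.mul_mem (A := 𝒜) (show (c : A) ∈ 𝒜 _ from hc) ha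

theorem HomogeneousSubalgebra.IsSplit.exists_map_irrelevant {C : HomogeneousSubalgebra 𝒜}
    (h : C.IsSplit) : ∃ π : A →ₗ[C.toSubalgebra] C.toSubalgebra,
      (∀ c : C.toSubalgebra, π (c : A) = c) ∧ ∀ a ∈ 𝒜₊.toIdeal, π a ∈ C.grading₊.toIdeal := by
  obtain ⟨π, hπ⟩ := h
  obtain ⟨ψ, hψ⟩ := exists_degreePreserving 𝒜 C.grading C.grading π
  have hψ_one : ψ 1 = 1 := by
    rw [hψ 0 1 SetLike.GradedOne.one_mem, ← OneMemClass.coe_one C.toSubalgebra, hπ]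
    exact homogeneousPart_of_mem C.grading SetLike.GradedOne.one_mem
  refine ⟨ψ, fun c => ?_, fun a ha => map_mem_irrelevant ψ.toAddMonoidHom (fun d a ha => ?_) ha⟩
  · rw [← mul_one (c : A)]
    exact (ψ.map_smul c 1).trans (by rw [hψ_one, smul_eq_mul, mul_one])
  · exact (hψ d a ha).symm ▸ homogeneousPart_mem _ _ _

end Irrelevant

theorem mem_smul_top_finsupp_iff {A ι : Type*} [CommRing A] {J : Ideal A} {x : ι →₀ A} :
    x ∈ J • (⊤ : Submodule A (ι →₀ A)) ↔ ∀ c, x c ∈ J := by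
  refine ⟨fun hx c => ?_, fun hx => ?_⟩
  · have hJ : J • (⊤ : Submodule A (ι →₀ A)) ≤
        Submodule.comap (Finsupp.lapply c) J :=
      Submodule.smul_le.mpr fun a ha y _ => J.mul_mem_right (y c) ha
    exact hJ hx
  · rw [← Finsupp.sum_single x]
    refine sum_mem fun c _ => ?_
    rw [← mul_one (x c), ← smul_eq_mul, ← Finsupp.smul_single]
    exact Submodule.smul_mem_smul (hx c) trivial

section Polynomial

open MvPolynomial

variable {n : ℕ} {k : Type*} [CommRing k]

/-- The sequence of variables, continued by zero. -/
def varSeq (n : ℕ) (k : Type*) [CommRing k] (r : ℕ) : MvPolynomial (Fin n) k :=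
  if h : r < n then X ⟨r, h⟩ else 0

theorem varSeq_mem (r : ℕ) : varSeq n k r ∈ homogeneousSubmodule (Fin n) k 1 := by
  unfold varSeq
  split_ifs with h
  · exact isHomogeneous_X k _
  · exact zero_mem _

theorem mem_irrelevant_iff_coeff (p : MvPolynomial (Fin n) k) :
    p ∈ (homogeneousSubmodule (Fin n) k)₊.toIdeal ↔ coeff 0 p = 0 := by
  have : homogeneousPart (homogeneousSubmodule (Fin n) k) 0 p = homogeneousComponent 0 p :=
    decomposition.decompose'_apply p 0
  rw [mem_irrelevant_iff_homogeneousPart, this, homogeneousComponent_zero, C_eq_zero]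

/-- The elements of a free module whose coordinates are sums of monomials that involve one of the
first `r` variables. -/
def varSpan (n : ℕ) (k : Type*) [CommRing k] (ι : Type*) (r : ℕ) :
    AddSubgroup (ι →₀ MvPolynomial (Fin n) k) where
  carrier := {y | ∀ c m, (∀ i : Fin n, (i : ℕ) < r → m i = 0) → coeff m (y c) = 0}
  add_mem' hx hy c m hm := by rw [Finsupp.add_apply, coeff_add, hx c m hm, hy c m hm, add_zero]
  zero_mem' _ _ _ := coeff_zero _
  neg_mem' hx c m hm := by rw [Finsupp.neg_apply, coeff_neg, hx c m hm, neg_zero]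

variable {ι : Type*}

theorem varSpan_zero : varSpan n k ι 0 = ⊥ :=
  (AddSubgroup.eq_bot_iff_forall _).mpr fun _ hy =>
    Finsupp.ext fun c => MvPolynomial.ext _ _ fun m => hy c m fun _ hi =>
      absurd hi (Nat.not_lt_zero _)

theorem exists_eq_add_smul_of_mem_varSpan_succ (r : ℕ) (hr : r < n)
    (y : ι →₀ MvPolynomial (Fin n) k) (hy : y ∈ varSpan n k ι (r + 1)) :
    ∃ q ∈ varSpan n k ι r, ∃ p, y = q + varSeq n k r • p := by
  refine ⟨y.mapRange (fun p => p.modMonomial (Finsupp.single ⟨r, hr⟩ 1)) ?_, ?_,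
    y.mapRange (fun p => p.divMonomial (Finsupp.single ⟨r, hr⟩ 1)) (zero_divMonomial _), ?_⟩
  · ext m
    by_cases h : Finsupp.single ⟨r, hr⟩ 1 ≤ m
    · rw [coeff_modMonomial_of_le _ h, coeff_zero]
    · rw [coeff_modMonomial_of_not_le _ h]
  · intro c m hm
    rw [Finsupp.mapRange_apply]
    by_cases h : Finsupp.single ⟨r, hr⟩ 1 ≤ m
    · rw [coeff_modMonomial_of_le _ h]
    · rw [coeff_modMonomial_of_not_le _ h]
      refine hy c m fun i hi => ?_
      rcases Nat.lt_succ_iff_lt_or_eq.mp hi with hi | hi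
      · exact hm i hi
      · obtain rfl : i = ⟨r, hr⟩ := Fin.ext hi
        by_contra h0
        exact h (Finsupp.single_le_iff.mpr (Nat.one_le_iff_ne_zero.mpr h0))
  · ext1 c
    simp only [varSeq, hr, dif_pos, Finsupp.add_apply, Finsupp.mapRange_apply,
      Finsupp.smul_apply, smul_eq_mul]
    exact (modMonomial_add_divMonomial_single (y c) ⟨r, hr⟩).symm

theorem mem_varSpan_of_smul_mem (r : ℕ) (hr : r < n) (y : ι →₀ MvPolynomial (Fin n) k)
    (hy : varSeq n k r • y ∈ varSpan n k ι r) : y ∈ varSpan n k ι r := by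
  intro c m hm
  have := hy c (Finsupp.single ⟨r, hr⟩ 1 + m) fun i hi => by
    have hne : (⟨r, hr⟩ : Fin n) ≠ i := fun h => by simp [← h] at hi
    rw [Finsupp.add_apply, Finsupp.single_eq_of_ne' hne, hm i hi]
  simpa only [varSeq, hr, dif_pos, Finsupp.smul_apply, smul_eq_mul, coeff_X_mul] using this

theorem smul_mem_varSpan (r i : ℕ) (hi : i < r) (y : ι →₀ MvPolynomial (Fin n) k) :
    varSeq n k i • y ∈ varSpan n k ι r := by
  intro c m hm
  unfold varSeq
  split_ifs with h
  · rw [Finsupp.smul_apply, smul_eq_mul, coeff_X_mul', if_neg]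
    simpa using hm ⟨i, h⟩ hi
  · rw [zero_smul, Finsupp.zero_apply, coeff_zero]

theorem exists_koszulD_zero_eq_of_mem_irrelevant_smul
    (f : KoszulIndex n 0 → (ι →₀ MvPolynomial (Fin n) k))
    (hf : ∀ s, f s ∈ (homogeneousSubmodule (Fin n) k)₊.toIdeal •
      (⊤ : Submodule (MvPolynomial (Fin n) k) (ι →₀ MvPolynomial (Fin n) k))) :
    ∃ g, koszulD (varSeq n k) n 0 g = f :=
  exists_koszulD_zero_eq (varSeq n k) (varSpan n k ι) varSpan_zero
    exists_eq_add_smul_of_mem_varSpan_succ le_rfl f fun s c m hm => by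
    obtain rfl : m = 0 := Finsupp.ext fun i => hm i i.2
    exact (mem_irrelevant_iff_coeff _).mp (mem_smul_top_finsupp_iff.mp (hf s) c)

theorem exact_koszulD_varSeq (j : ℕ) (f : KoszulIndex n (j + 1) → (ι →₀ MvPolynomial (Fin n) k))
    (hf : koszulD (varSeq n k) n j f = 0) : ∃ g, koszulD (varSeq n k) n (j + 1) g = f :=
  exact_koszulD (varSeq n k) (varSpan n k ι) varSpan_zero exists_eq_add_smul_of_mem_varSpan_succ
    mem_varSpan_of_smul_mem (fun r _ => smul_mem_varSpan r) le_rfl j f hf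

end Polynomial

section Generation

variable {k : Type*} [CommRing k] {A : Type*} [CommRing A] [Algebra k A] {𝒜 : ℕ → Submodule k A}
variable {M : Type*} [AddCommGroup M] [Module k M] [Module A M] [IsScalarTower k A M]
variable {ℳ : ℕ → Submodule k M} {Z N : Submodule A M}

/-- The degree `a` part of a submodule of a graded module. -/
def degreePart (ℳ : ℕ → Submodule k M) (Z : Submodule A M) (a : ℕ) : Submodule k M :=
  Z.restrictScalars k ⊓ ℳ a

theorem mem_degreePart {a : ℕ} {z : M} : z ∈ degreePart ℳ Z a ↔ z ∈ Z ∧ z ∈ ℳ a := Iff.rfl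

theorem smul_degreePart_le {I : Ideal A} {m : ℕ} (hI : ∀ b ∈ 𝒜 m, b ∈ I) (a : ℕ) :
    𝒜 m • degreePart ℳ Z a ≤ (I • Z).restrictScalars k := by
  refine Submodule.smul_le.mpr fun b hb z hz => ?_
  change b • z ∈ I • Z
  exact Submodule.smul_mem_smul (hI b hb) hz.1

/-- The graded module `Z ⧸ N` is generated in degrees at most `τ`. -/
def GeneratedUpTo (𝒜 : ℕ → Submodule k A) (ℳ : ℕ → Submodule k M) (Z N : Submodule A M) (τ : ℕ) :
    Prop :=
  ∀ a, τ ≤ a → degreePart ℳ Z (a + 1) ≤ N.restrictScalars k ⊔ 𝒜 1 • degreePart ℳ Z a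

theorem GeneratedUpTo.degreePart_le_sup [GradedAlgebra 𝒜] {τ : ℕ} (h : GeneratedUpTo 𝒜 ℳ Z N τ) :
    ∀ m, degreePart ℳ Z (τ + m) ≤ N.restrictScalars k ⊔ 𝒜 m • degreePart ℳ Z τ
  | 0 => le_sup_of_le_right fun z hz => by
    rw [← one_smul A z]
    exact Submodule.smul_mem_smul SetLike.GradedOne.one_mem hz
  | m + 1 => calc
      degreePart ℳ Z (τ + (m + 1))
        ≤ N.restrictScalars k ⊔ 𝒜 1 • degreePart ℳ Z (τ + m) := h (τ + m) (Nat.le_add_right τ m)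
      _ ≤ N.restrictScalars k ⊔ 𝒜 1 • (N.restrictScalars k ⊔ 𝒜 m • degreePart ℳ Z τ) :=
        sup_le_sup_left (Submodule.smul_mono le_rfl (h.degreePart_le_sup m)) _
      _ = N.restrictScalars k ⊔ 𝒜 1 • N.restrictScalars k ⊔
          (𝒜 1 * 𝒜 m) • degreePart ℳ Z τ := by
        rw [Submodule.smul_sup, ← Submodule.smul_assoc, smul_eq_mul, sup_assoc]
      _ ≤ N.restrictScalars k ⊔ 𝒜 (m + 1) • degreePart ℳ Z τ := by
        refine sup_le_sup (sup_le le_rfl ?_) (Submodule.smul_mono ?_ le_rfl)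
        · exact Submodule.smul_le.mpr fun b _ z hz => N.smul_mem b hz
        · rw [add_comm m 1]
          exact Submodule.mul_le.mpr fun b hb c hc => SetLike.GradedMul.mul_mem hb hc

theorem GeneratedUpTo.degreePart_le_of_lt [GradedAlgebra 𝒜] {τ e a : ℕ}
    (h : GeneratedUpTo 𝒜 ℳ Z N τ) {I : Ideal A} (hIZ : I • Z ≤ N)
    (hI : ∀ m, e < m → ∀ b ∈ 𝒜 m, b ∈ I) (ha : τ + e < a) :
    degreePart ℳ Z a ≤ N.restrictScalars k := by
  obtain ⟨m, rfl⟩ := Nat.exists_eq_add_of_le (show τ ≤ a by omega)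
  exact (h.degreePart_le_sup m).trans
    (sup_le le_rfl ((smul_degreePart_le (hI m (by omega)) τ).trans hIZ))

end Generation

section KoszulVanishes

variable {k : Type*} [CommRing k] {A : Type*} [CommRing A]
variable {M : Type*} [AddCommGroup M] [Module k M] [Module A M]
variable {ℳ : ℕ → Submodule k M} {Z N : Submodule A M} {x : ℕ → A} {r j a : ℕ}

/-- For homogeneous submodules `N ≤ Z`, the vanishing of the Koszul homology of `Z ⧸ N` with respect
to `x 0, …, x (r - 1)` in homological degree `j + 1` and with coefficients of degree `a`. -/
def KoszulVanishes (x : ℕ → A) (r : ℕ) (ℳ : ℕ → Submodule k M) (Z N : Submodule A M) (j a : ℕ) :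
    Prop :=
  ∀ f : KoszulIndex r (j + 1) → M, (∀ s, f s ∈ Z) → (∀ s, f s ∈ ℳ a) →
    (∀ s, koszulD x r j f s ∈ N) →
    ∃ g : KoszulIndex r (j + 2) → M, (∀ s, g s ∈ Z) ∧ ∀ s, f s - koszulD x r (j + 1) g s ∈ N

theorem KoszulVanishes.exists_eq (h : KoszulVanishes x r ℳ Z ⊥ j a) {f : KoszulIndex r (j + 1) → M}
    (hf : ∀ s, f s ∈ Z) (hfa : ∀ s, f s ∈ ℳ a) (hf_cycle : koszulD x r j f = 0) :
    ∃ g : KoszulIndex r (j + 2) → M, (∀ s, g s ∈ Z) ∧ koszulD x r (j + 1) g = f := by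
  obtain ⟨g, hg, hfg⟩ := h f hf hfa fun s => (Submodule.mem_bot A).mpr (congrFun hf_cycle s)
  exact ⟨g, hg, funext fun s => (sub_eq_zero.mp ((Submodule.mem_bot A).mp (hfg s))).symm⟩

theorem koszulVanishes_bot_iff : KoszulVanishes x r ℳ Z ⊥ j a ↔
    ∀ f : KoszulIndex r (j + 1) → M, (∀ s, f s ∈ Z) → (∀ s, f s ∈ ℳ a) → koszulD x r j f = 0 →
      ∃ g : KoszulIndex r (j + 2) → M, (∀ s, g s ∈ Z) ∧ koszulD x r (j + 1) g = f := by
  simp only [KoszulVanishes, Submodule.mem_bot, sub_eq_zero, funext_iff, Pi.zero_apply,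
    eq_comm (a := koszulD x r (j + 1) _ _)]

variable [Algebra k A] {𝒜 : ℕ → Submodule k A}

theorem koszulVanishes_of_degreePart_le [IsScalarTower k A M]
    (h : degreePart ℳ Z a ≤ N.restrictScalars k) (j : ℕ) : KoszulVanishes x r ℳ Z N j a :=
  fun f hf hfa _ => ⟨0, fun _ => zero_mem _, fun s => by
    rw [map_zero, Pi.zero_apply, sub_zero]
    exact h ⟨hf s, hfa s⟩⟩

variable (hx : ∀ i, x i ∈ 𝒜 1)
include hx

omit [Module k M] in
theorem koszulD_mem_irrelevant_smul [GradedAlgebra 𝒜] {f : KoszulIndex r (j + 1) → M}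
    (hf : ∀ s, f s ∈ Z) (s) : koszulD x r j f s ∈ 𝒜₊.toIdeal • Z :=
  koszulD_mem x (𝒜₊.toIdeal • Z).toAddSubgroup r j f
    (fun i _ s => Submodule.smul_mem_smul (mem_irrelevant_of_mem one_ne_zero (hx i)) (hf s)) s

theorem koszulD_mem_smul_degreePart [IsScalarTower k A M] {f : KoszulIndex r (j + 1) → M}
    (hf : ∀ s, f s ∈ Z) (hfa : ∀ s, f s ∈ ℳ a) (s) :
    koszulD x r j f s ∈ 𝒜 1 • degreePart ℳ Z a :=
  koszulD_mem x (𝒜 1 • degreePart ℳ Z a).toAddSubgroup r j f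
    (fun i _ s => Submodule.smul_mem_smul (hx i) ⟨hf s, hfa s⟩) s

variable [SetLike.GradedSMul 𝒜 ℳ]

theorem koszulD_mem_grading {f : KoszulIndex r (j + 1) → M} (hf : ∀ s, f s ∈ ℳ a) (s) :
    koszulD x r j f s ∈ ℳ (a + 1) := by
  refine koszulD_mem x (ℳ (a + 1)).toAddSubgroup r j f (fun i _ s => ?_) s
  rw [add_comm]
  exact SetLike.GradedSMul.smul_mem (hx i) (hf s)

variable [Decomposition ℳ]

theorem exists_homogeneous_primitive (hZ : Z.IsHomogeneous ℳ) {f : KoszulIndex r j → M}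
    (hf : ∀ s, f s ∈ ℳ (a + 1)) {g : KoszulIndex r (j + 1) → M} (hg : ∀ s, g s ∈ Z)
    (hfg : koszulD x r j g = f) :
    ∃ g' : KoszulIndex r (j + 1) → M,
      (∀ s, g' s ∈ Z) ∧ (∀ s, g' s ∈ ℳ a) ∧ koszulD x r j g' = f := by
  refine ⟨homogeneousPart ℳ a ∘ g, fun s => hZ a (hg s), fun s => homogeneousPart_mem ℳ a _,
    funext fun s => ?_⟩
  rw [← map_koszulD_apply x (homogeneousPart ℳ (1 + a)) (homogeneousPart ℳ a)
    (fun i m => homogeneousPart_smul ℳ 𝒜 (hx i) a m), hfg, add_comm 1 a]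
  exact homogeneousPart_of_mem ℳ (hf s)

/-- The exactness of `Tor_{j+2}(Z ⧸ N) → Tor_{j+1}(N) → Tor_{j+1}(Z)`. -/
theorem KoszulVanishes.sub (hZ : Z.IsHomogeneous ℳ) (hNZ : N ≤ Z)
    (h : KoszulVanishes x r ℳ Z ⊥ j (a + 1)) (h' : KoszulVanishes x r ℳ Z N (j + 1) a) :
    KoszulVanishes x r ℳ N ⊥ j (a + 1) := by
  refine koszulVanishes_bot_iff.mpr fun f hf hfa hf_cycle => ?_
  obtain ⟨g, hg, hfg⟩ := h.exists_eq (fun s => hNZ (hf s)) hfa hf_cycle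
  obtain ⟨g, hg, hga, rfl⟩ := exists_homogeneous_primitive hx hZ hfa hg hfg
  obtain ⟨p, -, hgp⟩ := h' g hg hga hf
  exact ⟨g - koszulD x r (j + 2) p, hgp, by rw [map_sub, koszulD_koszulD, sub_zero]⟩

/-- The exactness of `Tor_{j+2}(Z) → Tor_{j+2}(Z ⧸ N) → Tor_{j+1}(N)`. -/
theorem KoszulVanishes.quot (hN : N.IsHomogeneous ℳ) (hNZ : N ≤ Z)
    (h : KoszulVanishes x r ℳ N ⊥ j (a + 1)) (h' : KoszulVanishes x r ℳ Z ⊥ (j + 1) a) :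
    KoszulVanishes x r ℳ Z N (j + 1) a := by
  intro f hf hfa hf_cycle
  obtain ⟨p, hp, hfp⟩ := h.exists_eq hf_cycle (koszulD_mem_grading hx hfa) (koszulD_koszulD ..)
  obtain ⟨p, hp, hpa, hfp⟩ :=
    exists_homogeneous_primitive hx hN (koszulD_mem_grading hx hfa) hp hfp
  obtain ⟨g, hg, hfg⟩ := h'.exists_eq (f := f - p) (fun s => sub_mem (hf s) (hNZ (hp s)))
    (fun s => sub_mem (hfa s) (hpa s)) (by rw [map_sub, hfp, sub_self])
  refine ⟨g, hg, fun s => ?_⟩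
  rw [hfg, Pi.sub_apply, sub_sub_cancel]
  exact hp s

section Map

variable {M' : Type*} [AddCommGroup M'] [Module k M'] [Module A M'] {ℳ' : ℕ → Submodule k M'}
variable {D : M →ₗ[A] M'} (hD : ∀ d, ∀ y ∈ ℳ d, D y ∈ ℳ' d)
include hD

theorem exists_primitive_mem_ker {f : KoszulIndex r j → M} (hf : ∀ s, D (f s) = 0)
    (hfa : ∀ s, f s ∈ ℳ (a + 1)) {g : KoszulIndex r (j + 1) → M} (hfg : koszulD x r j g = f)
    (h : KoszulVanishes x r ℳ' (LinearMap.range D) ⊥ j a) :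
    ∃ g' : KoszulIndex r (j + 1) → M, (∀ s, g' s ∈ LinearMap.ker D) ∧ koszulD x r j g' = f := by
  obtain ⟨g, -, hga, hfg⟩ := exists_homogeneous_primitive hx
    (isHomogeneous_top (A := A) _) hfa (fun _ => trivial) hfg
  obtain ⟨p, hp, hgp⟩ := h.exists_eq (f := D ∘ g) (fun s => ⟨_, rfl⟩) (fun s => hD _ _ (hga s))
    (by rw [koszulD_comp_linearMap, hfg]; exact funext hf)
  choose q hq using hp
  obtain rfl : D ∘ q = p := funext hq
  refine ⟨g - koszulD x r (j + 1) q, fun s => ?_, by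
    rw [map_sub, koszulD_koszulD, sub_zero, hfg]⟩
  rw [LinearMap.mem_ker, Pi.sub_apply, map_sub, sub_eq_zero]
  exact (congrFun (koszulD_comp_linearMap x D r (j + 1) q ▸ hgp) s).symm

/-- The exactness of `Tor_{j+2}(im D) → Tor_{j+1}(ker D) → Tor_{j+1}(M)`. -/
theorem KoszulVanishes.ker (hM : KoszulVanishes x r ℳ (⊤ : Submodule A M) ⊥ j (a + 1))
    (h : KoszulVanishes x r ℳ' (LinearMap.range D) ⊥ (j + 1) a) :
    KoszulVanishes x r ℳ (LinearMap.ker D) ⊥ j (a + 1) := by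
  refine koszulVanishes_bot_iff.mpr fun f hf hfa hf_cycle => ?_
  obtain ⟨g, -, hfg⟩ := hM.exists_eq (fun _ => trivial) hfa hf_cycle
  exact exists_primitive_mem_ker hx hD hf hfa hfg h

end Map

omit [SetLike.GradedSMul 𝒜 ℳ] [Decomposition ℳ]

omit [Module k M] in
theorem KoszulVanishes.exists_single_smul [GradedAlgebra 𝒜] [DecidableEq (KoszulIndex r (j + 1))]
    {I : Ideal A} {e : ℕ} (hI : ∀ b ∈ 𝒜 (e + 1), b ∈ I) (h : KoszulVanishes x r 𝒜 ⊤ I j e)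
    (s : KoszulIndex r (j + 1)) {b : A} (hb : b ∈ 𝒜 e) {z : M} (hz : z ∈ Z) :
    ∃ g : KoszulIndex r (j + 2) → M, (∀ t, g t ∈ Z) ∧
      ∀ t, (Pi.single s (b • z) : KoszulIndex r (j + 1) → M) t -
        koszulD x r (j + 1) g t ∈ I • Z := by
  have hb_single (t) : (Pi.single s b : KoszulIndex r (j + 1) → A) t ∈ 𝒜 e := by
    rcases eq_or_ne t s with rfl | hts
    · rwa [Pi.single_eq_same]
    · rw [Pi.single_eq_of_ne hts]
      exact zero_mem _
  obtain ⟨g, -, hg⟩ := h _ (fun _ => trivial) hb_single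
    fun t => hI _ (koszulD_mem_grading hx hb_single t)
  let mulZ := LinearMap.toSpanSingleton A M z
  refine ⟨mulZ ∘ g, fun t => Z.smul_mem _ hz, fun t => ?_⟩
  have h_single : (Pi.single s (b • z) : KoszulIndex r (j + 1) → M) t =
      mulZ ((Pi.single s b : KoszulIndex r (j + 1) → A) t) :=
    (Pi.apply_single (fun _ => mulZ) (fun _ => map_zero mulZ) s b t).symm
  rw [koszulD_comp_linearMap, h_single, Function.comp_apply, ← map_sub]
  exact Submodule.smul_mem_smul (hg t) hz

theorem GeneratedUpTo.koszulVanishes [GradedAlgebra 𝒜] [IsScalarTower k A M] {τ e : ℕ}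
    (h : GeneratedUpTo 𝒜 ℳ Z N τ) {I : Ideal A} (hIZ : I • Z ≤ N) (hI : ∀ b ∈ 𝒜 (e + 1), b ∈ I)
    (hV : KoszulVanishes x r 𝒜 ⊤ I j e) : KoszulVanishes x r ℳ Z N j (τ + e) := by
  classical
  have : Fintype (KoszulIndex r (j + 1)) := Fintype.ofFinite _
  let chains (P : Submodule A M) (j : ℕ) : Submodule A (KoszulIndex r j → M) :=
    Submodule.pi Set.univ fun _ => P
  let E := chains N (j + 1) ⊔ (chains Z (j + 2)).map (koszulD x r (j + 1))
  have mem_E {f} : f ∈ E ↔ ∃ g : KoszulIndex r (j + 2) → M, (∀ s, g s ∈ Z) ∧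
      ∀ s, f s - koszulD x r (j + 1) g s ∈ N := by
    simp only [E, chains, Submodule.mem_sup', Subtype.exists, Submodule.mem_map]
    constructor
    · rintro ⟨p, hp, _, ⟨g, hg, rfl⟩, rfl⟩
      exact ⟨g, fun s => hg s trivial, fun s => by
        rw [Pi.add_apply, add_sub_cancel_right]
        exact hp s trivial⟩
    · rintro ⟨g, hg, hfg⟩
      exact ⟨_, fun s _ => hfg s, _, ⟨g, fun s _ => hg s, rfl⟩, sub_add_cancel f _⟩
  have h_single (s : KoszulIndex r (j + 1)) :
      N.restrictScalars k ⊔ 𝒜 e • degreePart ℳ Z τ ≤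
        (E.comap (LinearMap.single A (fun _ => M) s)).restrictScalars k := by
    refine sup_le (fun y hy => Submodule.mem_sup_left fun t _ => ?_) (Submodule.smul_le.mpr ?_)
    · rw [LinearMap.coe_single]
      rcases eq_or_ne t s with rfl | hts
      · rwa [Pi.single_eq_same]
      · rw [Pi.single_eq_of_ne hts]
        exact zero_mem _
    · intro b hb z hz
      obtain ⟨g, hg, hbg⟩ := hV.exists_single_smul hx hI s hb hz.1
      exact mem_E.mpr ⟨g, hg, fun t => hIZ (hbg t)⟩
  intro f hf hfa _
  rw [← mem_E, ← Finset.univ_sum_single f]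
  exact sum_mem fun s _ => h_single s (h.degreePart_le_sup e ⟨hf s, hfa s⟩)

end KoszulVanishes

section TorCriterion

variable {k : Type w} [CommRing k] {A : Type u} [CommRing A] [Algebra k A]

theorem tmul_one_eq_zero_iff {P : Type u} [AddCommGroup P] [Module A P] {ι : Type v}
    (b : Module.Basis ι A P) (J : Ideal A) (x : P) :
    x ⊗ₜ[A] (1 : A ⧸ J) = 0 ↔ b.repr x ∈ J • (⊤ : Submodule A (ι →₀ A)) := by
  have h_map : (J • (⊤ : Submodule A P)).map b.repr.toLinearMap = J • ⊤ := by
    rw [Submodule.map_smul'', Submodule.map_top, LinearEquiv.range]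
  rw [← TensorProduct.tensorQuotEquivQuotSMul_symm_mk, LinearEquiv.map_eq_zero_iff,
    Submodule.Quotient.mk_eq_zero, ← h_map,
    Submodule.mem_map_equiv, LinearEquiv.symm_apply_apply]

theorem exists_tmul_one_eq {P : Type u} [AddCommGroup P] [Module A P] (J : Ideal A)
    (z : P ⊗[A] (A ⧸ J)) : ∃ x : P, x ⊗ₜ[A] (1 : A ⧸ J) = z := by
  obtain ⟨x, hx⟩ := Submodule.Quotient.mk_surjective _ (TensorProduct.tensorQuotEquivQuotSMul P J z)
  exact ⟨x, by rw [← TensorProduct.tensorQuotEquivQuotSMul_symm_mk, hx,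
    LinearEquiv.symm_apply_apply]⟩

namespace GradedFreeResolution

variable {M : Type u} [AddCommGroup M] [Module k M] [Module A M]
variable {𝒜 : ℕ → Submodule k A} {ℳ : ℕ → Submodule k M} (F : GradedFreeResolution 𝒜 ℳ)

/-- The differential in coordinates. -/
def coordD (i : ℕ) : (F.ι (i + 1) →₀ A) →ₗ[A] (F.ι i →₀ A) :=
  (F.basis i).repr.toLinearMap ∘ₗ F.d i ∘ₗ (F.basis (i + 1)).repr.symm.toLinearMap

/-- The augmentation in coordinates. -/
def coordAug : (F.ι 0 →₀ A) →ₗ[A] M :=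
  F.aug ∘ₗ (F.basis 0).repr.symm.toLinearMap

theorem coordD_repr (i : ℕ) (x : F.F (i + 1)) :
    F.coordD i ((F.basis (i + 1)).repr x) = (F.basis i).repr (F.d i x) := by
  simp [coordD]

theorem coordAug_repr (x : F.F 0) : F.coordAug ((F.basis 0).repr x) = F.aug x := by
  simp [coordAug]

theorem coordD_mem (i d : ℕ) (x) (hx : x ∈ freeGrading 𝒜 (F.deg (i + 1)) d) :
    F.coordD i x ∈ freeGrading 𝒜 (F.deg i) d := by
  obtain ⟨x, rfl⟩ := (F.basis (i + 1)).repr.surjective x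
  rw [coordD_repr]
  exact F.d_mem i d x hx

theorem coordAug_mem (d : ℕ) (x) (hx : x ∈ freeGrading 𝒜 (F.deg 0) d) : F.coordAug x ∈ ℳ d := by
  obtain ⟨x, rfl⟩ := (F.basis 0).repr.surjective x
  rw [coordAug_repr]
  exact F.aug_mem d x hx

theorem exact_coordD (i : ℕ) : Function.Exact (F.coordD (i + 1)) (F.coordD i) := by
  intro x
  obtain ⟨x, rfl⟩ := (F.basis (i + 1)).repr.surjective x
  rw [coordD_repr, LinearEquiv.map_eq_zero_iff, F.exact_d i x, Set.mem_range, Set.mem_range,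
    (F.basis (i + 2)).repr.surjective.exists]
  simp only [coordD_repr, EmbeddingLike.apply_eq_iff_eq]

theorem exact_coordAug : Function.Exact (F.coordD 0) F.coordAug := by
  intro x
  obtain ⟨x, rfl⟩ := (F.basis 0).repr.surjective x
  rw [coordAug_repr, F.exact_aug x, Set.mem_range, Set.mem_range,
    (F.basis 1).repr.surjective.exists]
  simp only [coordD_repr, EmbeddingLike.apply_eq_iff_eq]

theorem coordAug_surjective : Function.Surjective F.coordAug :=
  F.aug_surjective.comp (F.basis 0).repr.symm.surjective

end GradedFreeResolution

variable {𝒜 : ℕ → Submodule k A} [GradedAlgebra 𝒜]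

theorem mem_tensorGrading_iff {P : Type u} [AddCommGroup P] [Module k P] [Module A P]
    [IsScalarTower k A P] {ι : Type v} (b : Module.Basis ι A P) (deg : ι → ℕ) (d : ℕ)
    (z : P ⊗[A] ResidueModule 𝒜) :
    z ∈ tensorGrading A (basisGrading 𝒜 b deg) (residueGrading 𝒜) d ↔
      ∃ x ∈ basisGrading 𝒜 b deg d, x ⊗ₜ[A] (1 : ResidueModule 𝒜) = z := by
  constructor
  · intro hz
    induction hz using Submodule.span_induction with
    | mem z hz =>
      obtain ⟨i, j, rfl, x, hx, _, ⟨a, ha, rfl⟩, rfl⟩ := hz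
      refine ⟨a • x, ?_, ?_⟩
      · change b.repr (a • x) ∈ freeGrading 𝒜 deg (i + j)
        rw [map_smul, add_comm]
        exact SetLike.GradedSMul.smul_mem (B := freeGrading 𝒜 deg) ha hx
      · rw [TensorProduct.smul_tmul, Algebra.smul_def, mul_one]
        rfl
    | zero => exact ⟨0, zero_mem _, TensorProduct.zero_tmul _ _⟩
    | add x y _ _ hx hy =>
      obtain ⟨x, hx, rfl⟩ := hx
      obtain ⟨y, hy, rfl⟩ := hy
      exact ⟨x + y, add_mem hx hy, TensorProduct.add_tmul _ _ _⟩
    | smul r x _ hx =>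
      obtain ⟨x, hx, rfl⟩ := hx
      exact ⟨r • x, Submodule.smul_mem _ r hx, TensorProduct.smul_tmul' _ _ _⟩
  · rintro ⟨x, hx, rfl⟩
    exact Submodule.subset_span ⟨d, 0, add_zero d, x, hx, 1,
      ⟨1, SetLike.GradedOne.one_mem, rfl⟩, rfl⟩

namespace GradedFreeResolution

variable {M : Type u} [AddCommGroup M] [Module k M] [Module A M]
variable {ℳ : ℕ → Submodule k M} (F : GradedFreeResolution 𝒜 ℳ)

theorem tmul_one_mem_boundaries_iff (i : ℕ) (x : F.F i) :
    x ⊗ₜ[A] (1 : ResidueModule 𝒜) ∈ F.boundaries (ResidueModule 𝒜) i ↔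
      ∃ y, (F.basis i).repr x - F.coordD i y ∈ 𝒜₊.toIdeal • (⊤ : Submodule A (F.ι i →₀ A)) := by
  have h_sub (y : F.F (i + 1)) : (F.basis i).repr x - F.coordD i ((F.basis (i + 1)).repr y) ∈
      𝒜₊.toIdeal • (⊤ : Submodule A (F.ι i →₀ A)) ↔
        (F.d i).rTensor (ResidueModule 𝒜) (y ⊗ₜ 1) = x ⊗ₜ 1 := by
    rw [coordD_repr, ← map_sub, ← tmul_one_eq_zero_iff, TensorProduct.sub_tmul, sub_eq_zero,
      eq_comm]
    rfl
  rw [boundaries, LinearMap.mem_range, (F.basis (i + 1)).repr.surjective.exists]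
  simp only [h_sub]
  constructor
  · rintro ⟨z, hz⟩
    obtain ⟨y, rfl⟩ := exists_tmul_one_eq _ z
    exact ⟨y, hz⟩
  · exact fun ⟨y, hy⟩ => ⟨y ⊗ₜ 1, hy⟩

theorem subsingleton_homology_iff (i d : ℕ) :
    Subsingleton (F.Homology (residueGrading 𝒜) i d) ↔
      ∀ x ∈ basisGrading 𝒜 (F.basis i) (F.deg i) d,
        x ⊗ₜ[A] 1 ∈ F.cycles (ResidueModule 𝒜) i →
        ∃ y, (F.basis i).repr x - F.coordD i y ∈
          𝒜₊.toIdeal • (⊤ : Submodule A (F.ι i →₀ A)) := by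
  rw [Submodule.Quotient.subsingleton_iff, Submodule.submoduleOf_eq_top]
  simp only [← tmul_one_mem_boundaries_iff]
  constructor
  · exact fun h x hx hx' => (h ⟨hx', (mem_tensorGrading_iff _ _ _ _).mpr ⟨x, hx, rfl⟩⟩).1
  · rintro h z ⟨hz, hzd⟩
    refine ⟨?_, hzd⟩
    obtain ⟨x, hx, rfl⟩ := (mem_tensorGrading_iff _ _ _ _).mp hzd
    exact h x hx hz

theorem subsingleton_homology_succ_iff (i d : ℕ) :
    Subsingleton (F.Homology (residueGrading 𝒜) (i + 1) d) ↔
      ∀ x ∈ freeGrading 𝒜 (F.deg (i + 1)) d,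
        F.coordD i x ∈ 𝒜₊.toIdeal • (⊤ : Submodule A (F.ι i →₀ A)) →
        ∃ y, x - F.coordD (i + 1) y ∈ 𝒜₊.toIdeal • (⊤ : Submodule A (F.ι (i + 1) →₀ A)) := by
  rw [subsingleton_homology_iff, (F.basis (i + 1)).repr.surjective.forall]
  refine forall_congr' fun x => forall_congr' fun _ => imp_congr_left ?_
  rw [coordD_repr, ← tmul_one_eq_zero_iff]
  rfl

theorem subsingleton_homology_zero_iff (d : ℕ) :
    Subsingleton (F.Homology (residueGrading 𝒜) 0 d) ↔
      ∀ x ∈ freeGrading 𝒜 (F.deg 0) d, ∃ y, x - F.coordD 0 y ∈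
          𝒜₊.toIdeal • (⊤ : Submodule A (F.ι 0 →₀ A)) := by
  rw [subsingleton_homology_iff, (F.basis 0).repr.surjective.forall]
  exact forall_congr' fun x => forall_congr' fun _ => imp_iff_right trivial

end GradedFreeResolution

end TorCriterion

section ModIrrelevant

variable {k : Type*} [CommRing k] {A : Type*} [CommRing A] [Algebra k A]
variable {𝒜 : ℕ → Submodule k A} [GradedAlgebra 𝒜]
variable {M : Type*} [AddCommGroup M] [Module k M] [Module A M] [IsScalarTower k A M]

/-- In degrees above `τ`, the map from `Z ⧸ A₊ Z` to `M ⧸ A₊ M` is injective; the condition is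
stated for an algebra that is generated in degree `1`, where `A₊ Z` is generated by `A₁ Z`. -/
def InjectiveModIrrelevant (𝒜 : ℕ → Submodule k A) [GradedAlgebra 𝒜] (ℳ : ℕ → Submodule k M)
    (Z : Submodule A M) (τ : ℕ) : Prop :=
  ∀ a, τ ≤ a → degreePart ℳ (Z ⊓ 𝒜₊.toIdeal • ⊤) (a + 1) ≤ 𝒜 1 • degreePart ℳ Z a

omit [IsScalarTower k A M] in
theorem isHomogeneous_irrelevant_smul_top (ℳ : ℕ → Submodule k M) [Decomposition ℳ]
    [SetLike.GradedSMul 𝒜 ℳ] : (𝒜₊.toIdeal • (⊤ : Submodule A M)).IsHomogeneous ℳ := by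
  classical
  intro d x hx
  change homogeneousPart ℳ d x ∈ _
  refine Submodule.smul_induction_on hx (fun a ha m _ => ?_) fun y z hy hz => ?_
  · rw [← sum_support_decompose 𝒜 a, ← sum_support_decompose ℳ m, Finset.sum_smul_sum, map_sum]
    refine sum_mem fun i _ => ?_
    rw [map_sum]
    refine sum_mem fun j _ => ?_
    have h_mem : (decompose 𝒜 a i : A) • (decompose ℳ m j : M) ∈ ℳ (i + j) :=
      SetLike.GradedSMul.smul_mem (A := 𝒜) (B := ℳ) (decompose 𝒜 a i).2 (decompose ℳ m j).2
    rcases eq_or_ne (i + j) d with rfl | hd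
    · rw [homogeneousPart_of_mem ℳ h_mem]
      exact Submodule.smul_mem_smul (𝒜₊.isHomogeneous i ha) trivial
    · rw [homogeneousPart_of_mem_ne ℳ h_mem hd]
      exact zero_mem _
  · rw [map_add]
    exact add_mem hy hz

variable {ι : Type*} {deg : ι → ℕ} {d : ℕ} {x : ι →₀ A}

omit [GradedAlgebra 𝒜] in
theorem apply_mem_of_mem_freeGrading (hx : x ∈ freeGrading 𝒜 deg d) {c : ι} (hc : deg c = d) :
    x c ∈ 𝒜 0 := by
  simpa only [twist, hc, le_refl, if_true, Nat.sub_self] using hx c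

theorem apply_mem_irrelevant_of_mem_freeGrading (hx : x ∈ freeGrading 𝒜 deg d) {c : ι}
    (hc : deg c ≠ d) : x c ∈ 𝒜₊.toIdeal := by
  have hxc := hx c
  unfold twist at hxc
  split_ifs at hxc with h
  · exact mem_irrelevant_of_mem (by omega) hxc
  · exact (Submodule.mem_bot k).mp hxc ▸ zero_mem _

end ModIrrelevant

section Connected

variable {k : Type*} [Field k] {A : Type*} [CommRing A] [Algebra k A] {𝒜 : ℕ → Submodule k A}
variable {I : Ideal A}

section Module

variable {M : Type*} [AddCommGroup M] [Module k M] [Module A M] [IsScalarTower k A M]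

theorem exists_finsupp_sum_eq_of_mem_smul {κ : Type*} {Q : Submodule k A} (v : Module.Basis κ k Q)
    {W : Submodule k M} {u : M} (hu : u ∈ Q • W) :
    ∃ w : κ →₀ M, (∀ j, w j ∈ W) ∧ (w.sum fun j y => (v j : A) • y) = u := by
  classical
  let Φ : (κ →₀ M) →ₗ[k] M :=
    Finsupp.lsum k fun j => DistribSMul.toLinearMap k M (v j : A)
  have h_le : Q • W ≤ (Finsupp.submodule fun _ => W).map Φ := by
    refine Submodule.smul_le.mpr fun q hq z hz => ?_
    let smulZ : Q →ₗ[k] M := (LinearMap.toSpanSingleton A M z).restrictScalars k ∘ₗ Q.subtype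
    have h_top : (⊤ : Submodule k Q) ≤ ((Finsupp.submodule fun _ => W).map Φ).comap smulZ := by
      rw [← v.span_eq, Submodule.span_le]
      rintro _ ⟨j, rfl⟩
      refine ⟨Finsupp.single j z, fun i => ?_, by simp [Φ, smulZ]⟩
      rw [Finsupp.single_apply]
      split_ifs
      exacts [hz, zero_mem W]
    exact h_top (x := ⟨q, hq⟩) trivial
  obtain ⟨w, hw, rfl⟩ := h_le hu
  exact ⟨w, hw, rfl⟩

theorem exists_complement_smul_le (I : Ideal A) (V : Submodule k A) : ∃ Q ≤ V,
    Disjoint (I.restrictScalars k) Q ∧ ∀ (Z : Submodule A M) (W : Submodule k M),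
      W ≤ Z.restrictScalars k → V • W ≤ (I • Z).restrictScalars k ⊔ Q • W := by
  obtain ⟨Q, hQ⟩ := Submodule.exists_isCompl (I.restrictScalars k ⊓ V)
  refine ⟨Q ⊓ V, inf_le_right, ?_, fun Z W hW => ?_⟩
  · rw [inf_comm, disjoint_iff, ← inf_assoc, hQ.inf_eq_bot]
  · have hV : V = I.restrictScalars k ⊓ V ⊔ Q ⊓ V := by
      rw [← sup_inf_assoc_of_le Q inf_le_right, hQ.sup_eq_top, top_inf_eq]
    conv_lhs => rw [hV, Submodule.sup_smul]
    refine sup_le_sup_right (Submodule.smul_le.mpr fun b hb z hz => ?_) _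
    change b • z ∈ I • Z
    exact Submodule.smul_mem_smul hb.1 (hW hz)

end Module

variable [GradedAlgebra 𝒜] {ι : Type*} {deg : ι → ℕ} {Z : Submodule A (ι →₀ A)}

theorem mem_irrelevant_smul_of_sum_mem (h𝒜 : 𝒜 0 ≤ 1) {κ : Type*} {Q : Submodule k A}
    (hQ : Disjoint (I.restrictScalars k) Q) (v : Module.Basis κ k Q) {d : ℕ}
    {w : κ →₀ (ι →₀ A)} (hw : ∀ j, w j ∈ freeGrading 𝒜 deg d)
    (hwI : (w.sum fun j y => (v j : A) • y) ∈ I • (⊤ : Submodule A (ι →₀ A))) (j : κ) :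
    w j ∈ 𝒜₊.toIdeal • (⊤ : Submodule A (ι →₀ A)) := by
  refine mem_smul_top_finsupp_iff.mpr fun c => ?_
  by_cases hc : deg c = d
  · have h_scalar (j) : ∃ r : k, algebraMap k A r = w j c :=
      Submodule.mem_one.mp (h𝒜 (apply_mem_of_mem_freeGrading (hw j) hc))
    choose r hr using h_scalar
    have h_coord : ((∑ j ∈ w.support, r j • v j : Q) : A) =
        (w.sum fun j y => (v j : A) • y) c := by
      simp only [Finsupp.sum, Submodule.coe_sum, Submodule.coe_smul, Finsupp.finsetSum_apply,
        Finsupp.smul_apply, smul_eq_mul, ← hr, Algebra.smul_def, mul_comm]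
    have h_zero : ∑ j ∈ w.support, r j • v j = 0 :=
      Subtype.ext <| Submodule.disjoint_def.mp hQ _
        (show _ ∈ I from h_coord ▸ mem_smul_top_finsupp_iff.mp hwI c) (Subtype.property _)
    by_cases hj : j ∈ w.support
    · rw [← hr, linearIndependent_iff'.mp v.linearIndependent _ _ h_zero j hj, map_zero]
      exact zero_mem _
    · rw [Finsupp.notMem_support_iff.mp hj]
      exact zero_mem _
  · exact apply_mem_irrelevant_of_mem_freeGrading (hw j) hc

theorem InjectiveModIrrelevant.smul_degreePart_succ_inf_le (h𝒜 : 𝒜 0 ≤ 1) {τ a : ℕ}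
    (h : InjectiveModIrrelevant 𝒜 (freeGrading 𝒜 deg) Z τ) (ha : τ ≤ a) (I : Ideal A) (m : ℕ) :
    𝒜 m • degreePart (freeGrading 𝒜 deg) Z (a + 1) ⊓ (I • ⊤ : Submodule A _).restrictScalars k ≤
      (I • Z).restrictScalars k ⊔ 𝒜 (m + 1) • degreePart (freeGrading 𝒜 deg) Z a := by
  rintro u ⟨hu, huI⟩
  obtain ⟨Q, hQ𝒜, hQ, h_le⟩ := exists_complement_smul_le (M := ι →₀ A) I (𝒜 m)
  obtain ⟨y, hy, p, hp, rfl⟩ := Submodule.mem_sup.mp (h_le Z _ inf_le_left hu)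
  obtain ⟨w, hw, rfl⟩ :=
    exists_finsupp_sum_eq_of_mem_smul (Module.Basis.ofVectorSpace k Q) hp
  have hyI : y ∈ I • (⊤ : Submodule A (ι →₀ A)) :=
    Submodule.smul_mono le_rfl le_top (show y ∈ I • Z from hy)
  have hwI : w.sum (fun j y => (Module.Basis.ofVectorSpace k Q j : A) • y) ∈
      I • (⊤ : Submodule A (ι →₀ A)) := (add_mem_cancel_left hyI).mp huI
  have hw_irrelevant := mem_irrelevant_smul_of_sum_mem h𝒜 hQ _ (fun j => (hw j).2) hwI
  refine add_mem (Submodule.mem_sup_left hy) (Submodule.mem_sup_right (sum_mem fun j _ => ?_))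
  have hj : (Module.Basis.ofVectorSpace k Q j : A) • w j ∈
      𝒜 m • 𝒜 1 • degreePart (freeGrading 𝒜 deg) Z a :=
    Submodule.smul_mem_smul (hQ𝒜 (Subtype.property _))
      (h a ha ⟨⟨(hw j).1, hw_irrelevant j⟩, (hw j).2⟩)
  rw [← Submodule.smul_assoc] at hj
  exact Submodule.smul_mono (Submodule.mul_le.mpr fun b hb c hc =>
    SetLike.GradedMul.mul_mem hb hc) le_rfl hj

theorem InjectiveModIrrelevant.degreePart_inf_smul_top_le (h𝒜 : 𝒜 0 ≤ 1) {τ e d : ℕ}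
    (h : InjectiveModIrrelevant 𝒜 (freeGrading 𝒜 deg) Z τ)
    (hI : ∀ m, e < m → ∀ b ∈ 𝒜 m, b ∈ I) (hd : τ + e < d) :
    degreePart (freeGrading 𝒜 deg) (Z ⊓ I • ⊤) d ≤ (I • Z).restrictScalars k := by
  rintro z ⟨⟨hz, hzI⟩, hzd⟩
  have h_descend (m : ℕ) (hm : m ≤ e + 1) :
      z ∈ (I • Z).restrictScalars k ⊔ 𝒜 m • degreePart (freeGrading 𝒜 deg) Z (d - m) := by
    induction m with
    | zero =>
      rw [← one_smul A z]
      exact Submodule.mem_sup_right (Submodule.smul_mem_smul SetLike.GradedOne.one_mem ⟨hz, hzd⟩)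
    | succ m ih =>
      obtain ⟨y, hy, u, hu, rfl⟩ := Submodule.mem_sup.mp (ih (by omega))
      have hyI : y ∈ I • (⊤ : Submodule A (ι →₀ A)) :=
        Submodule.smul_mono le_rfl le_top (show y ∈ I • Z from hy)
      have huI : u ∈ I • (⊤ : Submodule A (ι →₀ A)) := (add_mem_cancel_left hyI).mp hzI
      rw [show d - m = d - (m + 1) + 1 by omega] at hu
      exact add_mem (Submodule.mem_sup_left hy)
        (h.smul_degreePart_succ_inf_le h𝒜 (by omega) I m ⟨hu, huI⟩)
  have h_le := smul_degreePart_le (Z := Z) (ℳ := freeGrading 𝒜 deg) (hI (e + 1) (by omega))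
  exact sup_le le_rfl (h_le _) (h_descend (e + 1) le_rfl)

end Connected

section Polynomial

open MvPolynomial

variable {n : ℕ} {k : Type*} [CommRing k]

theorem exact_koszulD_varSeq_self (j : ℕ) (f : KoszulIndex n (j + 1) → MvPolynomial (Fin n) k)
    (hf : koszulD (varSeq n k) n j f = 0) : ∃ g, koszulD (varSeq n k) n (j + 1) g = f := by
  let e := Finsupp.uniqueLinearEquiv (MvPolynomial (Fin n) k) (MvPolynomial (Fin n) k) ()
  obtain ⟨g, hg⟩ := exact_koszulD_varSeq j (e.symm.toLinearMap ∘ f) (by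
    rw [koszulD_comp_linearMap, hf]
    exact funext fun _ => map_zero e.symm)
  refine ⟨e.toLinearMap ∘ g, funext fun s => ?_⟩
  rw [koszulD_comp_linearMap, hg]
  exact e.apply_symm_apply (f s)

theorem injectiveModIrrelevant_ker {k : Type u} [CommRing k] {ι ι' : Type u} {deg : ι → ℕ}
    {deg' : ι' → ℕ}
    {D : (ι →₀ MvPolynomial (Fin n) k) →ₗ[MvPolynomial (Fin n) k] (ι' →₀ MvPolynomial (Fin n) k)}
    (hD : ∀ d, ∀ x ∈ freeGrading (homogeneousSubmodule (Fin n) k) deg d,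
      D x ∈ freeGrading (homogeneousSubmodule (Fin n) k) deg' d) {τ : ℕ}
    (h : ∀ a, τ ≤ a → KoszulVanishes (varSeq n k) n
      (freeGrading (homogeneousSubmodule (Fin n) k) deg') (LinearMap.range D) ⊥ 0 a) :
    InjectiveModIrrelevant (homogeneousSubmodule (Fin n) k)
      (freeGrading (homogeneousSubmodule (Fin n) k) deg) (LinearMap.ker D) τ := by
  rintro a ha z ⟨⟨hz, hz_irrelevant⟩, hza⟩
  obtain ⟨g, hg⟩ :=
    exists_koszulD_zero_eq_of_mem_irrelevant_smul (fun _ => z) fun _ => hz_irrelevant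
  obtain ⟨g, hgD, hg⟩ :=
    exists_primitive_mem_ker varSeq_mem hD (fun _ => hz) (fun _ => hza) hg (h a ha)
  obtain ⟨g, hgD, hga, hg⟩ :=
    exists_homogeneous_primitive varSeq_mem (isHomogeneous_ker _ _ D hD) (fun _ => hza) hgD hg
  obtain ⟨s⟩ := KoszulIndex.nonempty_zero n
  rw [← congrFun hg s]
  exact koszulD_mem_smul_degreePart varSeq_mem hgD hga s

theorem injectiveModIrrelevant_top {k : Type u} [CommRing k] {ι : Type u} (deg : ι → ℕ) :
    InjectiveModIrrelevant (homogeneousSubmodule (Fin n) k)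
      (freeGrading (homogeneousSubmodule (Fin n) k) deg) ⊤ 0 := by
  let B := MvPolynomial (Fin n) k
  have h_ker := injectiveModIrrelevant_ker (D := (0 : (ι →₀ B) →ₗ[B] (ι →₀ B))) (deg := deg)
    (deg' := deg) (fun _ _ _ => zero_mem _) fun a (_ : 0 ≤ a) =>
      koszulVanishes_of_degreePart_le (by rintro _ ⟨⟨_, rfl⟩, -⟩; exact zero_mem _) 0
  rwa [LinearMap.ker_zero] at h_ker

section Resolution

variable {k : Type u} [CommRing k] {M : Type u} [AddCommGroup M] [Module k M]
variable [Module (MvPolynomial (Fin n) k) M] {ℳ : ℕ → Submodule k M} [Decomposition ℳ]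

theorem koszulVanishes_of_subsingleton_homology
    (F : GradedFreeResolution (homogeneousSubmodule (Fin n) k) ℳ) {a : ℕ}
    (hF : Subsingleton
      (F.Homology (residueGrading (homogeneousSubmodule (Fin n) k)) 1 (a + 1))) :
    KoszulVanishes (varSeq n k) n ℳ (⊤ : Submodule (MvPolynomial (Fin n) k) M) ⊥ 0 a := by
  rw [F.subsingleton_homology_succ_iff] at hF
  refine koszulVanishes_bot_iff.mpr fun f _ hfa hf_cycle => ?_
  choose g hga hgf using fun s =>
    exists_mem_of_mem_range _ ℳ F.coordAug F.coordAug_mem (F.coordAug_surjective (f s)) (hfa s)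
  obtain rfl : F.coordAug ∘ g = f := funext hgf
  have hg_aug (s) : F.coordAug (koszulD (varSeq n k) n 0 g s) = 0 := by
    rw [koszulD_comp_linearMap] at hf_cycle
    exact congrFun hf_cycle s
  choose w hwd hw using fun s => exists_mem_of_mem_range _ _ (F.coordD 0) (F.coordD_mem 0)
    ((F.exact_coordAug _).mp (hg_aug s)) (koszulD_mem_grading varSeq_mem hga s)
  choose y hy using fun s => hF (w s) (hwd s) (by
    rw [hw]
    exact koszulD_mem_irrelevant_smul varSeq_mem (fun _ => Submodule.mem_top) s)
  obtain ⟨v, hv⟩ := exists_koszulD_zero_eq_of_mem_irrelevant_smul _ hy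
  have h_cycle : koszulD (varSeq n k) n 0 (g - F.coordD 0 ∘ v) = 0 := funext fun s => by
    rw [map_sub, koszulD_comp_linearMap, hv, Pi.sub_apply, Function.comp_apply, map_sub,
      (F.exact_coordD 0).apply_apply_eq_zero, hw, sub_zero, sub_self, Pi.zero_apply]
  obtain ⟨h, hh⟩ := exact_koszulD_varSeq 0 _ h_cycle
  refine ⟨F.coordAug ∘ h, fun _ => trivial, ?_⟩
  rw [koszulD_comp_linearMap, hh]
  funext s
  simp only [Function.comp_apply, Pi.sub_apply, map_sub, F.exact_coordAug.apply_apply_eq_zero,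
    sub_zero]

end Resolution

theorem KoszulVanishes.of_ideal_grading {I : HomogeneousIdeal (homogeneousSubmodule (Fin n) k)}
    {j a : ℕ} (h : KoszulVanishes (varSeq n k) n I.grading
      (⊤ : Submodule (MvPolynomial (Fin n) k) I.toIdeal) ⊥ j a) :
    KoszulVanishes (varSeq n k) n (homogeneousSubmodule (Fin n) k) I.toIdeal ⊥ j a := by
  refine koszulVanishes_bot_iff.mpr fun f hf hfa hf_cycle => ?_
  let f' (s) : I.toIdeal := ⟨f s, hf s⟩
  have hf' : koszulD (varSeq n k) n j f' = 0 := funext fun s => Subtype.ext <|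
    (congrFun (koszulD_comp_linearMap (varSeq n k) I.toIdeal.subtype n j f') s).symm.trans
      (congrFun hf_cycle s)
  obtain ⟨g, -, hg⟩ := h.exists_eq (fun _ => trivial) (fun s => hfa s) hf'
  refine ⟨I.toIdeal.subtype ∘ g, fun s => (g s).2, ?_⟩
  rw [koszulD_comp_linearMap, hg]
  rfl

theorem koszulVanishes_quotient_of_subsingleton_homology {k : Type u} [CommRing k]
    {I : HomogeneousIdeal (homogeneousSubmodule (Fin n) k)}
    (F : GradedFreeResolution (homogeneousSubmodule (Fin n) k) I.grading) {e : ℕ}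
    (hF : Subsingleton
      (F.Homology (residueGrading (homogeneousSubmodule (Fin n) k)) 1 (e + 2))) :
    KoszulVanishes (varSeq n k) n (homogeneousSubmodule (Fin n) k) ⊤ I.toIdeal 1 e := by
  refine KoszulVanishes.quot varSeq_mem I.isHomogeneous le_top
    (koszulVanishes_of_subsingleton_homology F hF).of_ideal_grading ?_
  refine koszulVanishes_bot_iff.mpr fun f _ _ hf_cycle => ?_
  obtain ⟨g, hg⟩ := exact_koszulD_varSeq_self 1 f hf_cycle
  exact ⟨g, fun _ => trivial, hg⟩

end Polynomial

section FreeBaseChange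

variable {R : Type*} [CommRing R] (A : Type*) [CommRing A] [Algebra R A] {ι ι' ι'' : Type*}

/-- The inclusion of a free `R`-module into its extension of scalars to the `R`-algebra `A`, in
coordinates. -/
def freeInclusion (ι : Type*) : (ι →₀ R) →ₗ[R] (ι →₀ A) :=
  Finsupp.mapRange.linearMap (Algebra.linearMap R A)

theorem freeInclusion_apply (x : ι →₀ R) (c : ι) :
    freeInclusion A ι x c = algebraMap R A (x c) := rfl

theorem freeInclusion_single (c : ι) (a : R) :
    freeInclusion A ι (Finsupp.single c a) = Finsupp.single c (algebraMap R A a) :=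
  Finsupp.mapRange_single (hf := map_zero _)

variable (R) in
theorem single_eq_smul_freeInclusion (c : ι) (a : A) :
    Finsupp.single c a = a • freeInclusion A ι (Finsupp.single c (1 : R)) := by
  rw [freeInclusion_single, map_one, Finsupp.smul_single_one]

/-- The extension of scalars of a map of free modules, in coordinates. -/
def freeBaseChange (φ : (ι →₀ R) →ₗ[R] (ι' →₀ R)) : (ι →₀ A) →ₗ[A] (ι' →₀ A) :=
  Finsupp.linearCombination A fun c => freeInclusion A ι' (φ (Finsupp.single c 1))

variable (φ : (ι →₀ R) →ₗ[R] (ι' →₀ R))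

theorem freeBaseChange_freeInclusion (x : ι →₀ R) :
    freeBaseChange A φ (freeInclusion A ι x) = freeInclusion A ι' (φ x) := by
  induction x using Finsupp.induction_linear with
  | zero => simp only [map_zero]
  | add x y hx hy => simp only [map_add, hx, hy]
  | single c a =>
    rw [freeInclusion_single, ← Finsupp.smul_single_one c a, map_smul, map_smul, freeBaseChange,
      Finsupp.linearCombination_single, algebraMap_smul]

variable (R) {A} in
theorem free_linearMap_ext {f g : (ι →₀ A) →ₗ[A] (ι' →₀ A)}
    (h : ∀ x, f (freeInclusion A ι (x : ι →₀ R)) = g (freeInclusion A ι x)) : f = g :=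
  Finsupp.lhom_ext fun c a => by rw [single_eq_smul_freeInclusion R, map_smul, map_smul, h]

theorem freeBaseChange_comp (ψ : (ι' →₀ R) →ₗ[R] (ι'' →₀ R)) :
    freeBaseChange A (ψ ∘ₗ φ) = freeBaseChange A ψ ∘ₗ freeBaseChange A φ :=
  free_linearMap_ext R fun x => by
    simp only [freeBaseChange_freeInclusion, LinearMap.comp_apply]

theorem freeBaseChange_add (ψ : (ι →₀ R) →ₗ[R] (ι' →₀ R)) :
    freeBaseChange A (φ + ψ) = freeBaseChange A φ + freeBaseChange A ψ :=
  free_linearMap_ext R fun x => by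
    simp only [freeBaseChange_freeInclusion, LinearMap.add_apply, map_add]

theorem freeBaseChange_zero : freeBaseChange A (0 : (ι →₀ R) →ₗ[R] (ι' →₀ R)) = 0 :=
  free_linearMap_ext R fun x => by
    simp only [freeBaseChange_freeInclusion, LinearMap.zero_apply, map_zero]

theorem freeBaseChange_smul_id (a : R) :
    freeBaseChange A (a • LinearMap.id : (ι →₀ R) →ₗ[R] (ι →₀ R)) =
      algebraMap R A a • LinearMap.id :=
  free_linearMap_ext R fun x => by
    simp only [freeBaseChange_freeInclusion, LinearMap.smul_apply, LinearMap.id_apply, map_smul,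
      algebraMap_smul]

variable {A} (π : A →ₗ[R] R)

theorem mapRange_smul_freeInclusion (a : A) (y : ι →₀ R) :
    Finsupp.mapRange.linearMap π (a • freeInclusion A ι y) = π a • y := by
  ext c
  change π (a * algebraMap R A (y c)) = π a * y c
  rw [mul_comm, mul_comm (π a), ← smul_eq_mul (y c), ← map_smul, Algebra.smul_def]

theorem mapRange_freeInclusion (hπ : ∀ r, π (algebraMap R A r) = r) (y : ι →₀ R) :
    Finsupp.mapRange.linearMap π (freeInclusion A ι y) = y :=
  Finsupp.ext fun c => hπ (y c)

theorem mapRange_freeBaseChange (x : ι →₀ A) :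
    Finsupp.mapRange.linearMap π (freeBaseChange A φ x) =
      φ (Finsupp.mapRange.linearMap π x) := by
  induction x using Finsupp.induction_linear with
  | zero => simp only [map_zero]
  | add x y hx hy => simp only [map_add, hx, hy]
  | single c a =>
    rw [single_eq_smul_freeInclusion R, map_smul, freeBaseChange_freeInclusion,
      mapRange_smul_freeInclusion, mapRange_smul_freeInclusion, map_smul]

end FreeBaseChange

section GradedBaseChange

variable {k : Type w} [CommRing k] {R : Type u} [CommRing R] [Algebra k R]
variable {A : Type u} [CommRing A] [Algebra k A] [Algebra R A]
variable {ℛ : ℕ → Submodule k R} {𝒜 : ℕ → Submodule k A}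
variable {ι ι' : Type u} {deg : ι → ℕ} {deg' : ι' → ℕ} {d : ℕ}

theorem single_apply_mem_freeGrading {x : ι →₀ R} (hx : x ∈ freeGrading ℛ deg d) (c : ι) :
    Finsupp.single c (x c) ∈ freeGrading ℛ deg d := by
  classical
  intro c'
  rw [Finsupp.single_apply]
  split_ifs with h
  exacts [h ▸ hx c, zero_mem _]

section DegreePreserving

variable (hℛ : ∀ d, ∀ r ∈ ℛ d, algebraMap R A r ∈ 𝒜 d)
include hℛ

theorem freeInclusion_mem {x : ι →₀ R} (hx : x ∈ freeGrading ℛ deg d) :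
    freeInclusion A ι x ∈ freeGrading 𝒜 deg d := by
  intro c
  have hxc := hx c
  unfold twist at hxc ⊢
  split_ifs at hxc ⊢
  · exact hℛ _ _ hxc
  · rw [freeInclusion_apply, (Submodule.mem_bot k).mp hxc, map_zero]
    exact zero_mem _

variable [GradedAlgebra ℛ] [GradedAlgebra 𝒜]

theorem freeBaseChange_mem {φ : (ι →₀ R) →ₗ[R] (ι' →₀ R)}
    (hφ : ∀ d, ∀ x ∈ freeGrading ℛ deg d, φ x ∈ freeGrading ℛ deg' d) (d : ℕ) (x : ι →₀ A)
    (hx : x ∈ freeGrading 𝒜 deg d) : freeBaseChange A φ x ∈ freeGrading 𝒜 deg' d := by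
  refine linearCombination_mem deg (freeGrading 𝒜 deg') _ (fun c => ?_) hx
  have h_single := single_mem_freeGrading (𝒜 := ℛ) deg c SetLike.GradedOne.one_mem
  rw [zero_add] at h_single
  exact freeInclusion_mem hℛ (hφ _ _ h_single)

theorem freeInclusion_mem_irrelevant_smul {x : ι →₀ R}
    (hx : x ∈ ℛ₊.toIdeal • (⊤ : Submodule R (ι →₀ R))) :
    freeInclusion A ι x ∈ 𝒜₊.toIdeal • (⊤ : Submodule A (ι →₀ A)) :=
  mem_smul_top_finsupp_iff.mpr fun c =>
    map_mem_irrelevant (algebraMap R A).toAddMonoidHom hℛ (mem_smul_top_finsupp_iff.mp hx c)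

end DegreePreserving

variable [GradedAlgebra ℛ] [GradedAlgebra 𝒜]

theorem exists_sub_freeInclusion_mem [IsScalarTower k R A] (h𝒜 : 𝒜 0 ≤ 1) {z : ι →₀ A}
    (hz : z ∈ freeGrading 𝒜 deg d) : ∃ z' ∈ freeGrading ℛ deg d,
      z - freeInclusion A ι z' ∈ 𝒜₊.toIdeal • (⊤ : Submodule A (ι →₀ A)) := by
  have h_single (c : ι) : ∃ z' ∈ freeGrading ℛ deg d, Finsupp.single c (z c) -
      freeInclusion A ι z' ∈ 𝒜₊.toIdeal • (⊤ : Submodule A (ι →₀ A)) := by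
    by_cases hc : deg c = d
    · obtain ⟨r, hr⟩ := Submodule.mem_one.mp (h𝒜 (apply_mem_of_mem_freeGrading hz hc))
      refine ⟨Finsupp.single c (algebraMap k R r), ?_, ?_⟩
      · rw [← hc, ← zero_add (deg c)]
        exact single_mem_freeGrading deg c (SetLike.algebraMap_mem_graded ℛ r)
      · rw [freeInclusion_single, ← IsScalarTower.algebraMap_apply, hr, sub_self]
        exact zero_mem _
    · refine ⟨0, zero_mem _, ?_⟩
      rw [map_zero, sub_zero, ← Finsupp.smul_single_one]
      exact Submodule.smul_mem_smul (apply_mem_irrelevant_of_mem_freeGrading hz hc) trivial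
  choose z' hz' hzz' using h_single
  refine ⟨∑ c ∈ z.support, z' c, sum_mem fun c _ => hz' c, ?_⟩
  have h_sum := sum_mem fun c (_ : c ∈ z.support) => hzz' c
  rwa [Finset.sum_sub_distrib, ← map_sum, ← Finsupp.sum, Finsupp.sum_single] at h_sum

end GradedBaseChange

section Residue

variable {k : Type w} [CommRing k] {A : Type u} [CommRing A] [Algebra k A]
variable {𝒜 : ℕ → Submodule k A} [GradedAlgebra 𝒜]

theorem eq_zero_of_mem_residueGrading {d : ℕ} (hd : d ≠ 0) {x : ResidueModule 𝒜}
    (hx : x ∈ residueGrading 𝒜 d) : x = 0 := by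
  obtain ⟨a, ha, rfl⟩ := hx
  exact Ideal.Quotient.eq_zero_iff_mem.mpr (mem_irrelevant_of_mem hd ha)

theorem smul_residueModule_eq_zero {a : A} (ha : a ∈ 𝒜₊.toIdeal) (x : ResidueModule 𝒜) :
    a • x = 0 := by
  obtain ⟨b, rfl⟩ := Ideal.Quotient.mk_surjective x
  change Ideal.Quotient.mk _ (a * b) = 0
  exact Ideal.Quotient.eq_zero_iff_mem.mpr (Ideal.mul_mem_right _ _ ha)

namespace GradedFreeResolution

variable (F : GradedFreeResolution 𝒜 (residueGrading 𝒜))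

theorem mem_range_coordD_zero {d : ℕ} (hd : d ≠ 0) {x} (hx : x ∈ freeGrading 𝒜 (F.deg 0) d) :
    x ∈ LinearMap.range (F.coordD 0) :=
  (F.exact_coordAug x).mp (eq_zero_of_mem_residueGrading hd (F.coordAug_mem d x hx))

theorem subsingleton_homology_zero {d : ℕ} (hd : d ≠ 0) :
    Subsingleton (F.Homology (residueGrading 𝒜) 0 d) := by
  rw [F.subsingleton_homology_zero_iff]
  intro x hx
  obtain ⟨y, rfl⟩ := F.mem_range_coordD_zero hd hx
  exact ⟨y, by rw [sub_self]; exact zero_mem _⟩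

theorem nontrivial_homology_zero [Nontrivial (ResidueModule 𝒜)] :
    Nontrivial (F.Homology (residueGrading 𝒜) 0 0) := by
  rw [← not_subsingleton_iff_nontrivial, F.subsingleton_homology_zero_iff]
  intro h
  obtain ⟨x, hx, hx_one⟩ := exists_mem_of_mem_range (freeGrading 𝒜 (F.deg 0)) (residueGrading 𝒜)
    F.coordAug F.coordAug_mem (F.coordAug_surjective 1)
    (show (1 : ResidueModule 𝒜) ∈ residueGrading 𝒜 0 from ⟨1, SetLike.GradedOne.one_mem, rfl⟩)
  obtain ⟨y, hy⟩ := h x hx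
  have h_ker : 𝒜₊.toIdeal • (⊤ : Submodule A (F.ι 0 →₀ A)) ≤ LinearMap.ker F.coordAug :=
    Submodule.smul_le.mpr fun a ha z _ => by
      rw [LinearMap.mem_ker, map_smul, smul_residueModule_eq_zero ha]
  have hxy := h_ker hy
  rw [LinearMap.mem_ker, map_sub, hx_one, F.exact_coordAug.apply_apply_eq_zero, sub_zero] at hxy
  exact one_ne_zero hxy

section Homotopy

theorem exists_comp_eq_of_range_le {R P Q N : Type*} [CommRing R] [AddCommGroup P] [Module R P]
    [AddCommGroup Q] [Module R Q] [AddCommGroup N] [Module R N] [Module.Projective R N]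
    {φ : P →ₗ[R] Q} {ψ : N →ₗ[R] Q} (h : LinearMap.range ψ ≤ LinearMap.range φ) :
    ∃ s : N →ₗ[R] P, φ ∘ₗ s = ψ := by
  obtain ⟨s, hs⟩ := Module.projective_lifting_property φ.rangeRestrict
    (ψ.codRestrict _ fun x => h ⟨x, rfl⟩) φ.surjective_rangeRestrict
  exact ⟨s, LinearMap.ext fun x => congrArg Subtype.val (LinearMap.congr_fun hs x)⟩

theorem exists_homotopy_zero {a : A} (ha : a ∈ 𝒜₊.toIdeal) :
    ∃ s : (F.ι 0 →₀ A) →ₗ[A] (F.ι 1 →₀ A), F.coordD 0 ∘ₗ s = a • LinearMap.id := by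
  refine exists_comp_eq_of_range_le ?_
  rintro _ ⟨x, rfl⟩
  refine (F.exact_coordAug _).mp ?_
  rw [LinearMap.smul_apply, map_smul, smul_residueModule_eq_zero ha]

theorem exists_homotopy_of_comp_eq {a : A} {i : ℕ} {t : (F.ι i →₀ A) →ₗ[A] (F.ι (i + 1) →₀ A)}
    (ht : F.coordD i ∘ₗ t ∘ₗ F.coordD i = a • F.coordD i) :
    ∃ s : (F.ι (i + 1) →₀ A) →ₗ[A] (F.ι (i + 2) →₀ A),
      F.coordD (i + 1) ∘ₗ s + t ∘ₗ F.coordD i = a • LinearMap.id := by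
  have h_range : LinearMap.range (a • LinearMap.id - t ∘ₗ F.coordD i) ≤
      LinearMap.range (F.coordD (i + 1)) := by
    rintro _ ⟨x, rfl⟩
    refine (F.exact_coordD i _).mp ?_
    rw [LinearMap.sub_apply, map_sub, sub_eq_zero, LinearMap.smul_apply, map_smul]
    exact (LinearMap.congr_fun ht x).symm
  obtain ⟨s, hs⟩ := exists_comp_eq_of_range_le h_range
  exact ⟨s, LinearMap.ext fun x => eq_sub_iff_add_eq.mp (LinearMap.congr_fun hs x)⟩

theorem coordD_comp_coordD (i : ℕ) : F.coordD i ∘ₗ F.coordD (i + 1) = 0 :=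
  (F.exact_coordD i).linearMap_comp_eq_zero

/-- Multiplication by a positive-degree element is null-homotopic on the resolution, because it is
zero on the resolved module. -/
theorem exists_homotopy_succ {a : A} (ha : a ∈ 𝒜₊.toIdeal) :
    ∀ i, ∃ (t : (F.ι i →₀ A) →ₗ[A] (F.ι (i + 1) →₀ A))
      (s : (F.ι (i + 1) →₀ A) →ₗ[A] (F.ι (i + 2) →₀ A)),
      F.coordD (i + 1) ∘ₗ s + t ∘ₗ F.coordD i = a • LinearMap.id
  | 0 => by
    obtain ⟨t, ht⟩ := F.exists_homotopy_zero ha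
    exact ⟨t, F.exists_homotopy_of_comp_eq (by
      rw [← LinearMap.comp_assoc, ht, LinearMap.smul_comp, LinearMap.id_comp])⟩
  | i + 1 => by
    obtain ⟨t, s, hst⟩ := exists_homotopy_succ ha i
    refine ⟨s, F.exists_homotopy_of_comp_eq ?_⟩
    have h_comp := congrArg (· ∘ₗ F.coordD (i + 1)) hst
    simpa only [LinearMap.add_comp, LinearMap.comp_assoc, coordD_comp_coordD, LinearMap.comp_zero,
      add_zero, LinearMap.smul_comp, LinearMap.id_comp] using h_comp

end Homotopy

end GradedFreeResolution

end Residue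

namespace GradedFreeResolution

section Exact

variable {k : Type w} [CommRing k] {R : Type u} [CommRing R] [Algebra k R]
variable {ℛ : ℕ → Submodule k R} {M : Type u} [AddCommGroup M] [Module k M] [Module R M]
variable {ℳ : ℕ → Submodule k M} (F : GradedFreeResolution ℛ ℳ)

theorem exists_sub_coordD_mem_smul_top {J : Ideal R} {i : ℕ} {x : F.ι (i + 1) →₀ R}
    (hx : F.coordD i x ∈ J • LinearMap.range (F.coordD i)) :
    ∃ w, x - F.coordD (i + 1) w ∈ J • (⊤ : Submodule R (F.ι (i + 1) →₀ R)) := by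
  rw [← Submodule.map_top, ← Submodule.map_smul''] at hx
  obtain ⟨y, hy, hxy⟩ := hx
  obtain ⟨w, hw⟩ := (F.exact_coordD i (x - y)).mp (by rw [map_sub, hxy, sub_self])
  exact ⟨w, by rwa [hw, sub_sub_cancel]⟩

end Exact

variable {k : Type w} [CommRing k] {R : Type u} [CommRing R] [Algebra k R]
variable {ℛ : ℕ → Submodule k R} [GradedAlgebra ℛ]
variable (F : GradedFreeResolution ℛ (residueGrading ℛ))
variable (S : Type u) [CommRing S] [Algebra R S]

/-- The differential of the resolution, after extension of scalars to `S`. -/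
def extD (i : ℕ) : (F.ι (i + 1) →₀ S) →ₗ[S] (F.ι i →₀ S) :=
  freeBaseChange S (F.coordD i)

theorem extD_freeInclusion (i : ℕ) (x : F.ι (i + 1) →₀ R) :
    F.extD S i (freeInclusion S _ x) = freeInclusion S _ (F.coordD i x) :=
  freeBaseChange_freeInclusion S _ x

theorem extD_comp_extD (i : ℕ) : F.extD S i ∘ₗ F.extD S (i + 1) = 0 := by
  rw [extD, extD, ← freeBaseChange_comp, coordD_comp_coordD, freeBaseChange_zero]

/-- The cycles of the extended complex; in degree `0` these are the cycles of the complex without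
its augmentation. -/
def extCycles : ∀ i, Submodule S (F.ι i →₀ S)
  | 0 => ⊤
  | i + 1 => LinearMap.ker (F.extD S i)

theorem range_extD_le : ∀ i, LinearMap.range (F.extD S i) ≤ F.extCycles S i
  | 0 => le_top
  | i + 1 => LinearMap.range_le_ker_iff.mpr (F.extD_comp_extD S i)

theorem irrelevant_smul_extCycles_le (i : ℕ) :
    ℛ₊.toIdeal.map (algebraMap R S) • F.extCycles S i ≤ LinearMap.range (F.extD S i) := by
  rw [← Submodule.restrictScalars_le (S := R), Ideal.smul_restrictScalars]
  refine Submodule.smul_le.mpr fun a ha z hz => ?_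
  rw [← algebraMap_smul S]
  cases i with
  | zero =>
    obtain ⟨s, hs⟩ := F.exists_homotopy_zero ha
    have h_ext := congrArg (freeBaseChange S) hs
    rw [freeBaseChange_comp, freeBaseChange_smul_id] at h_ext
    exact ⟨_, LinearMap.congr_fun h_ext z⟩
  | succ i =>
    obtain ⟨t, s, hs⟩ := F.exists_homotopy_succ ha i
    have h_ext := LinearMap.congr_fun (congrArg (freeBaseChange S) hs) z
    have hz : freeBaseChange S (F.coordD i) z = 0 := hz
    rw [freeBaseChange_add, freeBaseChange_comp, freeBaseChange_comp, freeBaseChange_smul_id,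
      LinearMap.add_apply, LinearMap.comp_apply, LinearMap.comp_apply, hz, map_zero,
      add_zero] at h_ext
    exact ⟨_, h_ext⟩

section Split

variable {S} (π : S →ₗ[R] R)

theorem mapRange_extD (i : ℕ) (x : F.ι (i + 1) →₀ S) :
    Finsupp.mapRange.linearMap π (F.extD S i x) = F.coordD i (Finsupp.mapRange.linearMap π x) :=
  mapRange_freeBaseChange _ π x

theorem mapRange_mem_smul_range {J : Ideal S} {J' : Ideal R} (hπ : ∀ b ∈ J, π b ∈ J') {i : ℕ}
    {y : F.ι i →₀ S} (hy : y ∈ J • LinearMap.range (F.extD S i)) :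
    Finsupp.mapRange.linearMap π y ∈ J' • LinearMap.range (F.coordD i) := by
  rw [← Submodule.map_top, ← Submodule.map_smul''] at hy ⊢
  obtain ⟨u, hu, rfl⟩ := hy
  refine ⟨_, mem_smul_top_finsupp_iff.mpr fun c => ?_, (F.mapRange_extD π i u).symm⟩
  exact hπ _ (mem_smul_top_finsupp_iff.mp hu c)

theorem mapRange_mem_smul_range_of_mem_smul_extCycles {J : Ideal R} {i : ℕ}
    {y : F.ι (i + 1) →₀ S} (hy : y ∈ J.map (algebraMap R S) • F.extCycles S (i + 1)) :
    Finsupp.mapRange.linearMap π y ∈ J • LinearMap.range (F.coordD (i + 1)) := by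
  rw [← Submodule.restrictScalars_mem R, Ideal.smul_restrictScalars] at hy
  have h_map := Submodule.mem_map_of_mem (f := Finsupp.mapRange.linearMap π) hy
  rw [Submodule.map_smul''] at h_map
  refine Submodule.smul_mono le_rfl ?_ h_map
  rintro _ ⟨z, hz, rfl⟩
  refine (F.exact_coordD i _).mp ?_
  rw [← mapRange_extD, show F.extD S i z = 0 from hz, map_zero]

end Split

section Graded

variable {S} [Algebra k S] (𝒮 : ℕ → Submodule k S)

/-- The grading of the terms of the extended complex. -/
abbrev extGrading (i : ℕ) : ℕ → Submodule k (F.ι i →₀ S) :=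
  freeGrading 𝒮 (F.deg i)

variable [GradedAlgebra 𝒮] {𝒮}

theorem generatedUpTo_zero (h : InjectiveModIrrelevant 𝒮 (F.extGrading 𝒮 0) ⊤ 0) :
    GeneratedUpTo 𝒮 (F.extGrading 𝒮 0) (F.extCycles S 0) (LinearMap.range (F.extD S 0)) 0 := by
  rintro a - z ⟨-, hz⟩
  rw [← Finsupp.sum_single z]
  refine sum_mem fun c _ => ?_
  by_cases hc : F.deg 0 c = 0
  · refine Submodule.mem_sup_right (h a (Nat.zero_le a) ⟨⟨trivial, ?_⟩,
      single_apply_mem_freeGrading hz c⟩)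
    rw [← Finsupp.smul_single_one]
    exact Submodule.smul_mem_smul
      (apply_mem_irrelevant_of_mem_freeGrading hz (by omega)) Submodule.mem_top
  · have h_single := single_mem_freeGrading (𝒜 := ℛ) (F.deg 0) c SetLike.GradedOne.one_mem
    rw [zero_add] at h_single
    obtain ⟨y, hy⟩ := F.mem_range_coordD_zero hc h_single
    have h_range : Finsupp.single c (z c) ∈ LinearMap.range (F.extD S 0) := by
      rw [single_eq_smul_freeInclusion R, ← hy, ← extD_freeInclusion, ← map_smul]
      exact ⟨_, rfl⟩
    exact Submodule.mem_sup_left h_range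

variable (hℛ : ∀ d, ∀ r ∈ ℛ d, algebraMap R S r ∈ 𝒮 d)
include hℛ

theorem extD_mem (i d : ℕ) (x) (hx : x ∈ F.extGrading 𝒮 (i + 1) d) :
    F.extD S i x ∈ F.extGrading 𝒮 i d :=
  freeBaseChange_mem hℛ (F.coordD_mem i) d x hx

theorem isHomogeneous_extCycles : ∀ i, (F.extCycles S i).IsHomogeneous (F.extGrading 𝒮 i)
  | 0 => isHomogeneous_top _
  | i + 1 => isHomogeneous_ker _ _ _ (F.extD_mem hℛ i)

section Split

variable {π : S →ₗ[R] R} (hπ : ∀ r, π (algebraMap R S r) = r)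
  (hπ' : ∀ b ∈ 𝒮₊.toIdeal, π b ∈ ℛ₊.toIdeal)
include hπ hπ'

theorem exists_sub_extD_mem [IsScalarTower k R S] (h𝒮 : 𝒮 0 ≤ 1) {i d : ℕ}
    (h : Subsingleton (F.Homology (residueGrading ℛ) (i + 1) d)) {z : F.ι (i + 1) →₀ S}
    (hz : z ∈ F.extCycles S (i + 1)) (hzd : z ∈ F.extGrading 𝒮 (i + 1) d) :
    ∃ y, z - F.extD S (i + 1) y ∈ 𝒮₊.toIdeal • (⊤ : Submodule S (F.ι (i + 1) →₀ S)) := by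
  obtain ⟨z', hz', hzz'⟩ := exists_sub_freeInclusion_mem (ℛ := ℛ) h𝒮 hzd
  have hDz' : F.coordD i z' ∈ ℛ₊.toIdeal • (⊤ : Submodule R (F.ι i →₀ R)) := by
    have h_ext := neg_mem (Submodule.mem_comap.mp
      (Submodule.smul_top_le_comap_smul_top _ (F.extD S i) hzz'))
    rw [map_sub, show F.extD S i z = 0 from hz, zero_sub, neg_neg, extD_freeInclusion,
      mem_smul_top_finsupp_iff] at h_ext
    exact mem_smul_top_finsupp_iff.mpr fun c => hπ (F.coordD i z' c) ▸ hπ' _ (h_ext c)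
  obtain ⟨y, hy⟩ := (F.subsingleton_homology_succ_iff i d).mp h z' hz' hDz'
  refine ⟨freeInclusion S _ y, ?_⟩
  rw [extD_freeInclusion, ← sub_add_sub_cancel z (freeInclusion S _ z'), ← map_sub]
  exact add_mem hzz' (freeInclusion_mem_irrelevant_smul hℛ hy)

theorem generatedUpTo_succ [IsScalarTower k R S] (h𝒮 : 𝒮 0 ≤ 1) {i τ : ℕ}
    (h : InjectiveModIrrelevant 𝒮 (F.extGrading 𝒮 (i + 1)) (F.extCycles S (i + 1)) τ)
    (hF : ∀ d, τ < d → Subsingleton (F.Homology (residueGrading ℛ) (i + 1) d)) :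
    GeneratedUpTo 𝒮 (F.extGrading 𝒮 (i + 1)) (F.extCycles S (i + 1))
      (LinearMap.range (F.extD S (i + 1))) τ := by
  rintro a ha z ⟨hz, hza⟩
  obtain ⟨y, hy⟩ := F.exists_sub_extD_mem hℛ hπ hπ' h𝒮 (hF (a + 1) (by omega)) hz hza
  let w := homogeneousPart (F.extGrading 𝒮 (i + 1)) (a + 1) (F.extD S (i + 1) y)
  have hw : w ∈ LinearMap.range (F.extD S (i + 1)) :=
    isHomogeneous_range _ _ _ (F.extD_mem hℛ (i + 1)) (a + 1) ⟨y, rfl⟩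
  have hwa : w ∈ F.extGrading 𝒮 (i + 1) (a + 1) := homogeneousPart_mem _ _ _
  have hzw : z - w ∈ 𝒮₊.toIdeal • (⊤ : Submodule S (F.ι (i + 1) →₀ S)) := by
    have h_part := isHomogeneous_irrelevant_smul_top (F.extGrading 𝒮 (i + 1)) (a + 1) hy
    change homogeneousPart (F.extGrading 𝒮 (i + 1)) (a + 1) _ ∈ _ at h_part
    rwa [map_sub, homogeneousPart_of_mem _ hza] at h_part
  rw [← add_sub_cancel w z]
  exact add_mem (Submodule.mem_sup_left hw) (Submodule.mem_sup_right
    (h a ha ⟨⟨sub_mem hz (F.range_extD_le S _ hw), hzw⟩, sub_mem hza hwa⟩))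

theorem subsingleton_homology_one {e d : ℕ}
    (h : InjectiveModIrrelevant 𝒮 (F.extGrading 𝒮 0) ⊤ 0)
    (hI : ∀ m, e < m → ∀ b ∈ 𝒮 m, b ∈ ℛ₊.toIdeal.map (algebraMap R S)) (hd : e + 1 < d) :
    Subsingleton (F.Homology (residueGrading ℛ) 1 d) := by
  rw [F.subsingleton_homology_succ_iff]
  intro x hx hDx
  obtain ⟨a, rfl⟩ : ∃ a, d = a + 1 := ⟨d - 1, by omega⟩
  have h_le : degreePart (F.extGrading 𝒮 0) ⊤ a ≤
      degreePart (F.extGrading 𝒮 0) (LinearMap.range (F.extD S 0)) a :=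
    le_inf ((F.generatedUpTo_zero h).degreePart_le_of_lt (F.irrelevant_smul_extCycles_le S 0) hI
      (by omega)) inf_le_right
  have h_mem : freeInclusion S _ (F.coordD 0 x) ∈ 𝒮 1 • degreePart (F.extGrading 𝒮 0) ⊤ a :=
    h a (Nat.zero_le a) <| mem_degreePart.mpr
      ⟨Submodule.mem_inf.mpr ⟨trivial, freeInclusion_mem_irrelevant_smul hℛ hDx⟩,
        freeInclusion_mem hℛ (F.coordD_mem 0 _ x hx)⟩
  have h_range : freeInclusion S _ (F.coordD 0 x) ∈
      𝒮₊.toIdeal • LinearMap.range (F.extD S 0) :=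
    (Submodule.restrictScalars_mem k _ _).mp <|
      smul_degreePart_le (fun _ => mem_irrelevant_of_mem one_ne_zero) a
        (Submodule.smul_mono le_rfl h_le h_mem)
  refine F.exists_sub_coordD_mem_smul_top ?_
  have h_map := F.mapRange_mem_smul_range π hπ' h_range
  rwa [mapRange_freeInclusion π hπ] at h_map

end Split

end Graded

theorem subsingleton_homology_add_two {k : Type w} [Field k] {R : Type u} [CommRing R] [Algebra k R]
    {ℛ : ℕ → Submodule k R} [GradedAlgebra ℛ] (F : GradedFreeResolution ℛ (residueGrading ℛ))
    {S : Type u} [CommRing S] [Algebra R S] [Algebra k S] {𝒮 : ℕ → Submodule k S}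
    [GradedAlgebra 𝒮] (h𝒮 : 𝒮 0 ≤ 1) (hℛ : ∀ d, ∀ r ∈ ℛ d, algebraMap R S r ∈ 𝒮 d)
    {π : S →ₗ[R] R} (hπ : ∀ r, π (algebraMap R S r) = r) {i τ e d : ℕ}
    (h : InjectiveModIrrelevant 𝒮 (F.extGrading 𝒮 (i + 1)) (F.extCycles S (i + 1)) τ)
    (hI : ∀ m, e < m → ∀ b ∈ 𝒮 m, b ∈ ℛ₊.toIdeal.map (algebraMap R S)) (hd : τ + e < d) :
    Subsingleton (F.Homology (residueGrading ℛ) (i + 2) d) := by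
  rw [F.subsingleton_homology_succ_iff]
  intro x hx hDx
  have h_cycle : freeInclusion S _ (F.coordD (i + 1) x) ∈ F.extCycles S (i + 1) := by
    rw [← extD_freeInclusion]
    exact F.range_extD_le S (i + 1) ⟨_, rfl⟩
  have h_top : freeInclusion S _ (F.coordD (i + 1) x) ∈
      ℛ₊.toIdeal.map (algebraMap R S) • (⊤ : Submodule S (F.ι (i + 1) →₀ S)) :=
    mem_smul_top_finsupp_iff.mpr fun c =>
      Ideal.mem_map_of_mem _ (mem_smul_top_finsupp_iff.mp hDx c)
  have h_mem : freeInclusion S _ (F.coordD (i + 1) x) ∈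
      ℛ₊.toIdeal.map (algebraMap R S) • F.extCycles S (i + 1) :=
    h.degreePart_inf_smul_top_le h𝒮 hI hd <|
      mem_degreePart.mpr
        ⟨Submodule.mem_inf.mpr ⟨h_cycle, h_top⟩, freeInclusion_mem hℛ (F.coordD_mem (i + 1) d x hx)⟩
  refine F.exists_sub_coordD_mem_smul_top ?_
  have h_map := F.mapRange_mem_smul_range_of_mem_smul_extCycles π h_mem
  rwa [mapRange_freeInclusion π hπ] at h_map

end GradedFreeResolution

section Polynomial

open MvPolynomial

variable {n : ℕ} {k : Type u} [CommRing k] {ι : Type u}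

theorem koszulVanishes_top (deg : ι → ℕ) (j a : ℕ) :
    KoszulVanishes (varSeq n k) n (freeGrading (homogeneousSubmodule (Fin n) k) deg)
      (⊤ : Submodule (MvPolynomial (Fin n) k) _) ⊥ j a :=
  koszulVanishes_bot_iff.mpr fun f _ _ hf_cycle =>
    let ⟨g, hg⟩ := exact_koszulD_varSeq j f hf_cycle
    ⟨g, fun _ => Submodule.mem_top, hg⟩

theorem koszulVanishes_zero_of_isEmpty [IsEmpty (KoszulIndex n 2)] (deg : ι → ℕ)
    (N : Submodule (MvPolynomial (Fin n) k) (ι →₀ MvPolynomial (Fin n) k)) (a : ℕ) :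
    KoszulVanishes (varSeq n k) n (freeGrading (homogeneousSubmodule (Fin n) k) deg) N ⊥ 0 a :=
  koszulVanishes_bot_iff.mpr fun f _ _ hf_cycle =>
    let ⟨g, hg⟩ := exact_koszulD_varSeq 0 f hf_cycle
    ⟨g, isEmptyElim, hg⟩

theorem isEmpty_koszulIndex_of_koszulVanishes {k : Type*} [Field k]
    {I : Ideal (MvPolynomial (Fin n) k)} (hI : ∀ b ∈ homogeneousSubmodule (Fin n) k 1, b ∈ I)
    (hI_le : I ≤ (homogeneousSubmodule (Fin n) k)₊.toIdeal) {j : ℕ}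
    (h : KoszulVanishes (varSeq n k) n (homogeneousSubmodule (Fin n) k) ⊤ I j 0) :
    IsEmpty (KoszulIndex n (j + 1)) := by
  refine ⟨fun s => ?_⟩
  have h_one (_ : KoszulIndex n (j + 1)) :
      (1 : MvPolynomial (Fin n) k) ∈ homogeneousSubmodule (Fin n) k 0 := SetLike.GradedOne.one_mem
  obtain ⟨g, -, hg⟩ := h (fun _ => 1) (fun _ => Submodule.mem_top) h_one
    fun t => hI _ (koszulD_mem_grading varSeq_mem h_one t)
  have h_boundary : koszulD (varSeq n k) n (j + 1) g s ∈
      (homogeneousSubmodule (Fin n) k)₊.toIdeal := by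
    rw [← ((homogeneousSubmodule (Fin n) k)₊.toIdeal).mul_top]
    exact koszulD_mem_irrelevant_smul varSeq_mem (fun _ => Submodule.mem_top) s
  refine one_notMem_irrelevant (homogeneousSubmodule (Fin n) k) ?_
  rw [← sub_add_cancel 1 (koszulD (varSeq n k) n (j + 1) g s)]
  exact add_mem (hI_le (hg s)) h_boundary

end Polynomial

namespace GradedFreeResolution

section Bounds

open MvPolynomial

variable {k : Type u} [Field k] {R : Type u} [CommRing R] [Algebra k R]
variable {ℛ : ℕ → Submodule k R} [GradedAlgebra ℛ]
variable (F : GradedFreeResolution ℛ (residueGrading ℛ))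

/-- The bounds on the `i`-cycles of the complex extended to the polynomial ring that are propagated
from `i` to `i + 1`. -/
structure CyclesBounded (n : ℕ) [Algebra R (MvPolynomial (Fin n) k)] (e i τ : ℕ) : Prop where
  injective : InjectiveModIrrelevant (homogeneousSubmodule (Fin n) k)
    (F.extGrading (homogeneousSubmodule (Fin n) k) i) (F.extCycles (MvPolynomial (Fin n) k) i) τ
  generated : GeneratedUpTo (homogeneousSubmodule (Fin n) k)
    (F.extGrading (homogeneousSubmodule (Fin n) k) i) (F.extCycles (MvPolynomial (Fin n) k) i)
    (LinearMap.range (F.extD (MvPolynomial (Fin n) k) i)) τ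
  koszulVanishes : ∀ j a, τ + e ≤ a → KoszulVanishes (varSeq n k) n
    (F.extGrading (homogeneousSubmodule (Fin n) k) i) (F.extCycles (MvPolynomial (Fin n) k) i) ⊥ j
    (a + 1)

variable {n : ℕ} [Algebra R (MvPolynomial (Fin n) k)] {e i τ : ℕ}

theorem cyclesBounded_zero : F.CyclesBounded n e 0 0 where
  injective := injectiveModIrrelevant_top (F.deg 0)
  generated := F.generatedUpTo_zero (injectiveModIrrelevant_top (F.deg 0))
  koszulVanishes j a _ := koszulVanishes_top (F.deg 0) j (a + 1)

variable {F} (hℛ : ∀ d, ∀ r ∈ ℛ d,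
  algebraMap R (MvPolynomial (Fin n) k) r ∈ homogeneousSubmodule (Fin n) k d)
variable (hI : ∀ m, e < m → ∀ b ∈ homogeneousSubmodule (Fin n) k m,
  b ∈ ℛ₊.toIdeal.map (algebraMap R (MvPolynomial (Fin n) k)))

namespace CyclesBounded

section Koszul

include hℛ hI

theorem koszulVanishes_range (h : F.CyclesBounded n e i τ) (j : ℕ) {a : ℕ} (ha : τ + e < a) :
    KoszulVanishes (varSeq n k) n (F.extGrading (homogeneousSubmodule (Fin n) k) i)
      (LinearMap.range (F.extD (MvPolynomial (Fin n) k) i)) ⊥ j (a + 1) :=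
  (h.koszulVanishes j a ha.le).sub varSeq_mem (F.isHomogeneous_extCycles hℛ i)
    (F.range_extD_le _ i) (koszulVanishes_of_degreePart_le
      (h.generated.degreePart_le_of_lt (F.irrelevant_smul_extCycles_le _ i) hI ha) (j + 1))

theorem koszulVanishes_range_of_quotient (h : F.CyclesBounded n e i τ)
    (hV : KoszulVanishes (varSeq n k) n (homogeneousSubmodule (Fin n) k) ⊤
      (ℛ₊.toIdeal.map (algebraMap R (MvPolynomial (Fin n) k))) 1 e) :
    KoszulVanishes (varSeq n k) n (F.extGrading (homogeneousSubmodule (Fin n) k) i)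
      (LinearMap.range (F.extD (MvPolynomial (Fin n) k) i)) ⊥ 0 (τ + e + 1) :=
  (h.koszulVanishes 0 (τ + e) le_rfl).sub varSeq_mem (F.isHomogeneous_extCycles hℛ i)
    (F.range_extD_le _ i) (h.generated.koszulVanishes varSeq_mem
      (F.irrelevant_smul_extCycles_le _ i) (hI (e + 1) (Nat.lt_succ_self e)) hV)

end Koszul

variable {π : MvPolynomial (Fin n) k →ₗ[R] R}
variable (hπ : ∀ r, π (algebraMap R (MvPolynomial (Fin n) k) r) = r)
variable (hπ' : ∀ b ∈ (homogeneousSubmodule (Fin n) k)₊.toIdeal, π b ∈ ℛ₊.toIdeal)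
include hℛ hI hπ hπ'

theorem subsingleton_homology (h : F.CyclesBounded n e i τ) {d : ℕ} (hd : τ + e + 1 < d) :
    Subsingleton (F.Homology (residueGrading ℛ) (i + 1) d) := by
  cases i with
  | zero =>
    exact F.subsingleton_homology_one hℛ hπ hπ' (injectiveModIrrelevant_top _) hI (by omega)
  | succ i =>
    exact F.subsingleton_homology_add_two (homogeneousSubmodule_zero _).le hℛ hπ h.injective hI
      (by omega)

variable [IsScalarTower k R (MvPolynomial (Fin n) k)]

theorem succ (h : F.CyclesBounded n e i τ) {τ' : ℕ} (hτe : τ + e + 1 ≤ τ') (hτ : τ + 2 ≤ τ')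
    (hV : ∀ a, τ' ≤ a → KoszulVanishes (varSeq n k) n
      (F.extGrading (homogeneousSubmodule (Fin n) k) i)
      (LinearMap.range (F.extD (MvPolynomial (Fin n) k) i)) ⊥ 0 a) :
    F.CyclesBounded n e (i + 1) τ' := by
  have h_injective := injectiveModIrrelevant_ker (F.extD_mem hℛ i) hV
  refine ⟨h_injective, F.generatedUpTo_succ hℛ hπ hπ' (homogeneousSubmodule_zero _).le h_injective
    fun d hd => h.subsingleton_homology hℛ hI hπ hπ' (by omega), fun j a ha => ?_⟩
  obtain ⟨a, rfl⟩ : ∃ b, a = b + 1 := ⟨a - 1, by omega⟩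
  exact KoszulVanishes.ker varSeq_mem (F.extD_mem hℛ i) (koszulVanishes_top _ j _)
    (h.koszulVanishes_range hℛ hI (j + 1) (by omega))

end CyclesBounded

variable [IsScalarTower k R (MvPolynomial (Fin n) k)] {π : MvPolynomial (Fin n) k →ₗ[R] R}
variable (hπ : ∀ r, π (algebraMap R (MvPolynomial (Fin n) k) r) = r)
variable (hπ' : ∀ b ∈ (homogeneousSubmodule (Fin n) k)₊.toIdeal, π b ∈ ℛ₊.toIdeal)
include hℛ hI hπ hπ'

variable (F)

theorem cyclesBounded : ∀ i, F.CyclesBounded n e i ((e + 2) * i)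
  | 0 => F.cyclesBounded_zero
  | i + 1 => by
    have h := cyclesBounded i
    refine h.succ hℛ hI hπ hπ' (by lia) (by lia) fun a ha => ?_
    obtain ⟨a, rfl⟩ : ∃ b, a = b + 1 := ⟨a - 1, by lia⟩
    exact h.koszulVanishes_range hℛ hI 0 (by lia)

theorem subsingleton_homology_of_lt (i : ℕ) {d : ℕ} (hd : (e + 2) * (i + 1) + e < d) :
    Subsingleton (F.Homology (residueGrading ℛ) (i + 2) d) :=
  F.subsingleton_homology_add_two (homogeneousSubmodule_zero _).le hℛ hπ
    (F.cyclesBounded hℛ hI hπ hπ' (i + 1)).injective hI hd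

variable (hV : KoszulVanishes (varSeq n k) n (homogeneousSubmodule (Fin n) k) ⊤
  (ℛ₊.toIdeal.map (algebraMap R (MvPolynomial (Fin n) k))) 1 e)
include hV

theorem cyclesBounded_of_koszulVanishes (he : e ≠ 0) :
    ∀ i, F.CyclesBounded n e i ((e + 1) * i)
  | 0 => F.cyclesBounded_zero
  | i + 1 => by
    have h := cyclesBounded_of_koszulVanishes he i
    refine h.succ hℛ hI hπ hπ' (by lia) (by lia) fun a ha => ?_
    obtain rfl | ha := ha.eq_or_lt
    · exact h.koszulVanishes_range_of_quotient hℛ hI hV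
    · obtain ⟨a, rfl⟩ : ∃ b, a = b + 1 := ⟨a - 1, by lia⟩
      exact h.koszulVanishes_range hℛ hI 0 (by lia)

theorem subsingleton_homology_of_koszulVanishes (i : ℕ) {d : ℕ} (hd : (e + 1) * (i + 1) + e < d) :
    Subsingleton (F.Homology (residueGrading ℛ) (i + 2) d) := by
  rcases eq_or_ne e 0 with rfl | he
  -- For `e = 0` the extended ideal is the irrelevant ideal, and `hV` forces `n ≤ 1`.
  · have := isEmpty_koszulIndex_of_koszulVanishes (hI 1 zero_lt_one) (map_irrelevant_le hℛ) hV
    exact F.subsingleton_homology_add_two (homogeneousSubmodule_zero _).le hℛ hπ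
      (injectiveModIrrelevant_ker (τ := 0) (F.extD_mem hℛ i) fun a _ =>
        koszulVanishes_zero_of_isEmpty _ _ a) hI (by omega)
  · exact F.subsingleton_homology_add_two (homogeneousSubmodule_zero _).le hℛ hπ
      (F.cyclesBounded_of_koszulVanishes hℛ hI hπ hπ' hV he (i + 1)).injective hI hd

end Bounds

end GradedFreeResolution

section GradedEnd

variable {X : ℕ → Type*}

theorem gradedEnd_le_iff {b : EReal} :
    gradedEnd X ≤ b ↔ ∀ d, Nontrivial (X d) → (d : EReal) ≤ b :=
  iSup₂_le_iff

theorem le_gradedEnd (d : ℕ) [h : Nontrivial (X d)] : (d : EReal) ≤ gradedEnd X :=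
  gradedEnd_le_iff.mp le_rfl d h

theorem gradedEnd_le_natCast {b : ℕ} (h : ∀ d, b < d → Subsingleton (X d)) : gradedEnd X ≤ b :=
  gradedEnd_le_iff.mpr fun d hd => Nat.cast_le.mpr <|
    not_lt.mp fun hbd => not_subsingleton_iff_nontrivial.mpr hd (h d hbd)

theorem subsingleton_of_gradedEnd_lt {d : ℕ} (h : gradedEnd X < d) : Subsingleton (X d) :=
  not_nontrivial_iff_subsingleton.mp fun _ => h.not_ge (le_gradedEnd d)

theorem gradedEnd_eq_top_or_natCast (d : ℕ) [h : Nontrivial (X d)] :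
    gradedEnd X = ⊤ ∨ ∃ N : ℕ, gradedEnd X = N := by
  classical
  by_cases hb : ∃ N, ∀ d, Nontrivial (X d) → d ≤ N
  · obtain ⟨N, hN⟩ := hb
    have : Nontrivial (X (Nat.findGreatest (fun d => Nontrivial (X d)) N)) :=
      Nat.findGreatest_spec (P := fun d => Nontrivial (X d)) (hN d h) h
    exact .inr ⟨_, le_antisymm (gradedEnd_le_iff.mpr fun d hd =>
      Nat.cast_le.mpr (Nat.le_findGreatest (hN d hd) hd)) (le_gradedEnd _)⟩
  · push Not at hb
    refine .inl (EReal.eq_top_iff_forall_lt _ |>.mpr fun y => ?_)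
    obtain ⟨N, hN⟩ := exists_nat_gt y
    obtain ⟨d, _, hNd⟩ := hb N
    refine lt_of_lt_of_le ?_ (le_gradedEnd d)
    exact_mod_cast hN.trans (Nat.cast_lt.mpr hNd)

end GradedEnd

theorem natCast_sub_ereal {a b : ℕ} (h : b ≤ a) : ((a - b : ℕ) : EReal) = a - b := by
  rw [← EReal.coe_coe_eq_natCast, Nat.cast_sub h, EReal.coe_sub]
  rfl

section Residue

variable {k : Type w} [CommRing k] {A : Type u} [CommRing A] [Algebra k A]
variable (𝒜 : ℕ → Submodule k A) [GradedAlgebra 𝒜]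

theorem nontrivial_residueModule [Nontrivial A] : Nontrivial (ResidueModule 𝒜) :=
  Ideal.Quotient.nontrivial_iff.mpr <|
    (Ideal.ne_top_iff_one _).mpr (one_notMem_irrelevant 𝒜)

theorem torEnd_residue_zero [Nontrivial A] : torEnd 𝒜 (residueGrading 𝒜) 0 = 0 := by
  have := nontrivial_residueModule 𝒜
  have := (GradedFreeResolution.nonempty 𝒜 (residueGrading 𝒜)).some.nontrivial_homology_zero
  refine le_antisymm ?_ ?_
  · exact_mod_cast gradedEnd_le_natCast (b := 0) fun d hd =>
      GradedFreeResolution.subsingleton_homology_zero _ hd.ne'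
  · exact_mod_cast le_gradedEnd
      (X := fun d => GradedTor 𝒜 (residueGrading 𝒜) (residueGrading 𝒜) 0 d) 0

variable {𝒜} {I : HomogeneousIdeal 𝒜}

theorem mem_of_subsingleton_quotientGrading {d : ℕ} [Subsingleton (I.quotientGrading d)] {a : A}
    (ha : a ∈ 𝒜 d) : a ∈ I.toIdeal :=
  Ideal.Quotient.eq_zero_iff_mem.mp <| congrArg Subtype.val <|
    Subsingleton.elim (⟨Ideal.Quotient.mk I.toIdeal a, a, ha, rfl⟩ : I.quotientGrading d) 0

theorem nontrivial_quotientGrading_zero (hI : (1 : A) ∉ I.toIdeal) :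
    Nontrivial (I.quotientGrading 0) :=
  not_subsingleton_iff_nontrivial.mp fun _ =>
    hI (mem_of_subsingleton_quotientGrading SetLike.GradedOne.one_mem)

theorem mem_of_gradedEnd_quotientGrading_eq {N : ℕ}
    (hN : gradedEnd (fun d => I.quotientGrading d) = N) (d : ℕ) (hd : N < d) (a : A)
    (ha : a ∈ 𝒜 d) : a ∈ I.toIdeal :=
  have := subsingleton_of_gradedEnd_lt (hN.trans_lt (Nat.cast_lt.mpr hd))
  mem_of_subsingleton_quotientGrading ha

end Residue

namespace HomogeneousSubalgebra

variable {k : Type u} [Field k] {n : ℕ}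
variable {C : HomogeneousSubalgebra (MvPolynomial.homogeneousSubmodule (Fin n) k)}

theorem algebraMap_mem (d : ℕ) (c : C.toSubalgebra) (hc : c ∈ C.grading d) :
    algebraMap C.toSubalgebra (MvPolynomial (Fin n) k) c ∈
      MvPolynomial.homogeneousSubmodule (Fin n) k d := hc

variable (C) in
theorem gradedEnd_extendedIrrelevant_eq_top_or_natCast :
    gradedEnd (fun d => C.extendedIrrelevant.quotientGrading d) = ⊤ ∨
      ∃ N : ℕ, gradedEnd (fun d => C.extendedIrrelevant.quotientGrading d) = N :=
  have := nontrivial_quotientGrading_zero (I := C.extendedIrrelevant) fun h_one =>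
    one_notMem_irrelevant _ (map_irrelevant_le C.algebraMap_mem h_one)
  gradedEnd_eq_top_or_natCast 0

theorem IsSplit.torEnd_one_le (h : C.IsSplit) :
    torEnd C.grading (residueGrading C.grading) 1 ≤
      gradedEnd (fun d => C.extendedIrrelevant.quotientGrading d) + 1 := by
  obtain ⟨π, hπ, hπ'⟩ := h.exists_map_irrelevant
  obtain h_top | ⟨N, hN⟩ := C.gradedEnd_extendedIrrelevant_eq_top_or_natCast
  · rw [h_top]
    exact le_top
  · have h_le : torEnd C.grading (residueGrading C.grading) 1 ≤ (N + 1 : ℕ) :=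
      gradedEnd_le_natCast fun d hd => GradedFreeResolution.subsingleton_homology_one _
        C.algebraMap_mem hπ hπ' (injectiveModIrrelevant_top _)
        (mem_of_gradedEnd_quotientGrading_eq hN) hd
    rw [hN]
    exact_mod_cast h_le

theorem IsSplit.torEnd_add_two_le (h : C.IsSplit) (i : ℕ) :
    torEnd C.grading (residueGrading C.grading) (i + 2) ≤
      (gradedEnd (fun d => C.extendedIrrelevant.quotientGrading d) + 2) * (i + 2 : ℕ) - 2 := by
  obtain ⟨π, hπ, hπ'⟩ := h.exists_map_irrelevant
  obtain h_top | ⟨N, hN⟩ := C.gradedEnd_extendedIrrelevant_eq_top_or_natCast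
  · rw [h_top, show (⊤ : EReal) + 2 = ⊤ from rfl,
      EReal.top_mul_of_pos (mod_cast Nat.succ_pos _)]
    exact le_top
  · have h_le : torEnd C.grading (residueGrading C.grading) (i + 2) ≤
        ((N + 2) * (i + 2) - 2 : ℕ) :=
      gradedEnd_le_natCast fun d hd => GradedFreeResolution.subsingleton_homology_of_lt _
        C.algebraMap_mem (mem_of_gradedEnd_quotientGrading_eq hN) hπ hπ' i
        (by rw [mul_add] at hd ⊢; omega)
    rw [natCast_sub_ereal (by rw [mul_add]; omega)] at h_le
    rw [hN]
    exact_mod_cast h_le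

theorem IsSplit.torEnd_add_two_le_of_torEnd_one_le (h : C.IsSplit)
    (h_one : torEnd (MvPolynomial.homogeneousSubmodule (Fin n) k) C.extendedIrrelevant.grading 1 ≤
      gradedEnd (fun d => C.extendedIrrelevant.quotientGrading d) + 1) (i : ℕ) :
    torEnd C.grading (residueGrading C.grading) (i + 2) ≤
      (gradedEnd (fun d => C.extendedIrrelevant.quotientGrading d) + 1) * (i + 2 : ℕ) - 1 := by
  obtain ⟨π, hπ, hπ'⟩ := h.exists_map_irrelevant
  obtain h_top | ⟨N, hN⟩ := C.gradedEnd_extendedIrrelevant_eq_top_or_natCast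
  · rw [h_top, show (⊤ : EReal) + 1 = ⊤ from rfl,
      EReal.top_mul_of_pos (mod_cast Nat.succ_pos _)]
    exact le_top
  · rw [hN] at h_one ⊢
    have hV := koszulVanishes_quotient_of_subsingleton_homology _ <|
      subsingleton_of_gradedEnd_lt (d := N + 2) <|
        h_one.trans_lt (by exact_mod_cast Nat.lt_succ_self (N + 1))
    have h_le : torEnd C.grading (residueGrading C.grading) (i + 2) ≤
        ((N + 1) * (i + 2) - 1 : ℕ) :=
      gradedEnd_le_natCast fun d hd => GradedFreeResolution.subsingleton_homology_of_koszulVanishes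
        _ C.algebraMap_mem (mem_of_gradedEnd_quotientGrading_eq hN) hπ hπ' hV i
        (by rw [mul_add] at hd ⊢; omega)
    rw [natCast_sub_ereal (by rw [mul_add]; omega)] at h_le
    exact_mod_cast h_le

end HomogeneousSubalgebra

end

theorem theorem1p3 {k : Type u} [Field k] (n : ℕ)
    (C : HomogeneousSubalgebra (MvPolynomial.homogeneousSubmodule (Fin n) k))
    (hsplit : C.IsSplit)
    (I : HomogeneousIdeal (MvPolynomial.homogeneousSubmodule (Fin n) k))
    (hI : I = C.extendedIrrelevant)
    (e : EReal) (he : e = gradedEnd fun d => I.quotientGrading d) :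
    torEnd C.grading (residueGrading C.grading) 0 = 0 ∧
    torEnd C.grading (residueGrading C.grading) 1 ≤ e + 1 ∧
    (∀ i : ℕ, 2 ≤ i →
      torEnd C.grading (residueGrading C.grading) i ≤ (e + 2) * (i : EReal) - 2) ∧
    (torEnd (MvPolynomial.homogeneousSubmodule (Fin n) k) I.grading 1 ≤ e + 1 →
      ∀ i : ℕ, 2 ≤ i →
        torEnd C.grading (residueGrading C.grading) i ≤ (e + 1) * (i : EReal) - 1) := by
  subst hI he
  refine ⟨torEnd_residue_zero C.grading, hsplit.torEnd_one_le, fun i hi => ?_, fun h i hi => ?_⟩ <;>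
    obtain ⟨i, rfl⟩ := Nat.exists_eq_add_of_le' hi
  · exact hsplit.torEnd_add_two_le i
  · exact hsplit.torEnd_add_two_le_of_torEnd_one_le h i
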